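/- Let $k$ be an infinite field, and for $m\ge 0$ let $S(m)=k[x_1,\ldots,x_m]$ be the standard graded polynomial ring in $m$ variables; put $S=S(n)$. If $l=c_1x_1+\cdots+c_mx_m$ is a linear form in $S(m)$ with $c_m\neq 0$, let $\pi_l\colon S(m)\to S(m)/(l)\cong S(m-1)$ be the projection, where the isomorphism is the inverse of the one induced by the inclusion $S(m-1)\hookrightarrow S(m)$. For linear forms $l_1,\ldots,l_s\in S$ put $\Pi_{l_1\ldots l_s}=\pi_{\overline{l_s}}\cdots\pi_{\overline{l_2}}\,\pi_{l_1}\colon S\to S(n-s)$, where $\overline{l_i}$ is the image of $l_i$ under $\Pi_{l_1\ldots l_{i-1}}$; this is defined if at every step the coefficient of the last variable is nonzero. For a proper homogeneous ideal $I\subset S(m)$ with $D=\dim S(m)/I$ (Krull dimension), write the Hilbert series as $\sum_{j\ge 0}\dim_k\big((S(m)/I)_j\big)\,t^j=q(t)/(1-t)^{D}$ with $q(t)\in\mathbb Z[t]$, and define the Hilbert coefficients $e_i(S(m)/I)\in\mathbb Z$ by $q(t)=\sum_{i\ge 0}e_i(S(m)/I)\,(t-1)^i$. Let $\operatorname{depth}(S/I)$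 be the supremum of the lengths of $S/I$-regular sequences contained in $(x_1,\ldots,x_n)$. Let $P$ be a homogeneous prime ideal of $S$ with $\dim(S/P)=d$, let $1\le s\le d$, and let $r=n-s$. Then for $s$ general linear forms $l_1,\ldots,l_s$ in $S$ (that is, for all $s$-tuples of linear forms whose coefficient vectors lie in some nonempty Zariski open subset, depending on $P$ and $s$, of $(k^n)^s$) the map $\Pi_{l_1\ldots l_s}$ is defined, and with $P_s=\Pi_{l_1\ldots l_s}(P)\subset S(r)$ the following hold. (1) $e_i(S/P)=e_i(S(r)/P_s)$ for all $0\le i\le d-s-1$. (2) If $e_{d-s}(S/P)=e_{d-s}(S(r)/P_s)-(-1)^{d-s}$, then $\operatorname{depth}(S/P)=n-r-1=s-1$. -/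

import Mathlib

open MvPolynomial

noncomputable section

namespace HilbertDepth

variable {k : Type*} [Field k]

/-- The linear form `a₁ x₁ + ⋯ + aₙ xₙ` with coefficient vector `a`. -/
def linearForm {n : ℕ} (a : Fin n → k) : MvPolynomial (Fin n) k :=
  ∑ i, C (a i) * X i

/-- The coefficient of `x_i` in `l`. -/
def linCoeff {n : ℕ} (l : MvPolynomial (Fin n) k) (i : Fin n) : k :=
  coeff (Finsupp.single i 1) l

/-- The projection `π_l : S(m+1) → S(m)` along a linear form `l = ∑ cᵢ xᵢ` whose last coefficient
`c` is nonzero: it fixes all variables but the last one, and solves `l = 0` for the last one.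
By `proj_rename`, `proj_self` and `ker_proj` below it is the composite
`S(m+1) → S(m+1)/(l) ≃ S(m)`, the inverse of the isomorphism being induced by the inclusion
`S(m) ↪ S(m+1)`. -/
def proj {m : ℕ} (l : MvPolynomial (Fin (m + 1)) k) :
    MvPolynomial (Fin (m + 1)) k →ₐ[k] MvPolynomial (Fin m) k :=
  aeval (Fin.snoc (α := fun _ => MvPolynomial (Fin m) k) X
    (∑ i : Fin m, C (-(linCoeff l (Fin.last m))⁻¹ * linCoeff l i.castSucc) * X i))

/-- The iterated projection `Π_{l₁ … l_s} : S(r+s) → S(r)`: apply `π_{l₁}`, then continue with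
the images of `l₂, …, l_s` under `π_{l₁}`. -/
def iterProj : (s r : ℕ) → (Fin s → MvPolynomial (Fin (r + s)) k) →
    (MvPolynomial (Fin (r + s)) k →ₐ[k] MvPolynomial (Fin r) k)
  | 0, r, _ => AlgHom.id k (MvPolynomial (Fin r) k)
  | s + 1, r, l =>
    (iterProj s r (fun i => proj (m := r + s) (l 0) (l i.succ))).comp (proj (m := r + s) (l 0))

/-- The condition for `Π_{l₁ … l_s}` to make sense: at each stage the coefficient of the last
variable in the current linear form is nonzero. -/
def IterProjDefined : (s r : ℕ) → (Fin s → MvPolynomial (Fin (r + s)) k) → Prop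
  | 0, _, _ => True
  | s + 1, r, l => linCoeff (l 0) (Fin.last (r + s)) ≠ 0 ∧
      IterProjDefined s r (fun i => proj (m := r + s) (l 0) (l i.succ))

/-- Zariski open subsets of the affine space of `s`-tuples of linear forms in `n` variables,
identified with their coefficients: complements of common zero sets of polynomials. -/
def IsZariskiOpen {s n : ℕ} (U : Set (Fin s → Fin n → k)) : Prop :=
  ∃ F : Set (MvPolynomial (Fin s × Fin n) k),
    U = {a | ∃ f ∈ F, eval (fun p => a p.1 p.2) f ≠ 0}

/-- The property `Q` holds for `s` general linear forms in `n` variables: it holds on a nonempty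
Zariski open set of `s`-tuples of linear forms. -/
def ForGeneralLinearForms (s n : ℕ) (Q : (Fin s → MvPolynomial (Fin n) k) → Prop) : Prop :=
  ∃ U : Set (Fin s → Fin n → k), IsZariskiOpen U ∧ U.Nonempty ∧
    ∀ a ∈ U, Q (fun j => linearForm (a j))

attribute [local instance] MvPolynomial.gradedAlgebra in
/-- `I` is a homogeneous ideal for the standard grading of the polynomial ring. -/
def IsHomogeneousIdeal {n : ℕ} (I : Ideal (MvPolynomial (Fin n) k)) : Prop :=
  I.IsHomogeneous (homogeneousSubmodule (Fin n) k)

/-- The Hilbert function of the standard graded algebra `S/I`: `m ↦ dim_k (S/I)_m`, where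
`(S/I)_m` is the image of the space of forms of degree `m`. -/
def hilbertFunction {n : ℕ} (I : Ideal (MvPolynomial (Fin n) k)) (m : ℕ) : ℕ :=
  Module.finrank k
    ((homogeneousSubmodule (Fin n) k m).map (Ideal.Quotient.mkₐ k I).toLinearMap)

/-- The Hilbert series of `S/I`. -/
def hilbertSeries {n : ℕ} (I : Ideal (MvPolynomial (Fin n) k)) : PowerSeries ℤ :=
  PowerSeries.mk fun m => (hilbertFunction I m : ℤ)

/-- The Krull dimension of `S/I` as a natural number (`0` if `I` is the unit ideal). -/
def quotientDim {n : ℕ} (I : Ideal (MvPolynomial (Fin n) k)) : ℕ :=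
  ((ringKrullDim (MvPolynomial (Fin n) k ⧸ I)).unbotD 0).toNat

open Classical in
/-- The polynomial `q(t) = h(t) (1 - t) ^ dim (S/I) ∈ ℤ[t]`, where `h` is the Hilbert series of
`S/I`. By the Hilbert-Serre theorem this power series is a polynomial if `I` is homogeneous. -/
def hilbertNumerator {n : ℕ} (I : Ideal (MvPolynomial (Fin n) k)) : Polynomial ℤ :=
  if h : ∃ q : Polynomial ℤ,
      (q : PowerSeries ℤ) = hilbertSeries I * (1 - PowerSeries.X) ^ quotientDim I
  then h.choose else 0

/-- The `i`-th Hilbert coefficient `e_i(S/I)`: the coefficient of `(t - 1) ^ i` in the expansion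
of `q(t)` in powers of `t - 1`. -/
def hilbertCoeff {n : ℕ} (I : Ideal (MvPolynomial (Fin n) k)) (i : ℕ) : ℤ :=
  (Polynomial.taylor 1 (hilbertNumerator I)).coeff i

/-- The depth of `S/I` with respect to the homogeneous maximal ideal `(x₁, …, xₙ)`: the supremum
of the lengths of the `S/I`-regular sequences contained in `(x₁, …, xₙ)`. -/
def depthQuotient {n : ℕ} (I : Ideal (MvPolynomial (Fin n) k)) : ℕ∞ :=
  ⨆ rs : {rs : List (MvPolynomial (Fin n) k) //
      RingTheory.Sequence.IsRegular (MvPolynomial (Fin n) k ⧸ I) rs ∧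
        ∀ f ∈ rs, f ∈ idealOfVars (Fin n) k},
    (rs.1.length : ℕ∞)

lemma linCoeff_linearForm {n : ℕ} (a : Fin n → k) (i : Fin n) :
    linCoeff (linearForm a) i = a i := by
  classical
  simp [linCoeff, linearForm, coeff_sum, coeff_C_mul, coeff_X, Finsupp.single_left_inj]

lemma proj_rename {m : ℕ} (l : MvPolynomial (Fin (m + 1)) k) (f : MvPolynomial (Fin m) k) :
    proj l (rename Fin.castSucc f) = f := by
  have h : (Fin.snoc (α := fun _ => MvPolynomial (Fin m) k) X
    (∑ i : Fin m, C (-(linCoeff l (Fin.last m))⁻¹ * linCoeff l i.castSucc) * X i)) ∘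
      Fin.castSucc = X := by
    funext i; simp
  rw [proj, aeval_rename, h, aeval_X_left_apply]

lemma proj_self {m : ℕ} (a : Fin (m + 1) → k) (ha : a (Fin.last m) ≠ 0) :
    proj (linearForm a) (linearForm a) = 0 := by
  simp only [proj, linCoeff_linearForm]
  rw [linearForm, Fin.sum_univ_castSucc]
  simp only [map_add, map_sum, map_mul, aeval_X, algHom_C, Fin.snoc_castSucc, Fin.snoc_last,
    Finset.mul_sum, ← Finset.sum_add_distrib, algebraMap_eq]
  refine Finset.sum_eq_zero fun i _ => ?_
  rw [← mul_assoc, ← C_mul, ← C_mul, ← add_mul, ← map_add C]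
  rw [show a i.castSucc + a (Fin.last m) * (-(a (Fin.last m))⁻¹ * a i.castSucc) = 0 by
    field_simp; ring]
  simp

lemma ker_proj {m : ℕ} (a : Fin (m + 1) → k) (ha : a (Fin.last m) ≠ 0) :
    RingHom.ker (proj (linearForm a)) = Ideal.span {linearForm a} := by
  refine le_antisymm ?_ ?_
  · have key : (Ideal.Quotient.mkₐ k (Ideal.span {linearForm a})).comp
        ((rename Fin.castSucc).comp (proj (linearForm a))) =
        Ideal.Quotient.mkₐ k (Ideal.span {linearForm a}) := by
      apply algHom_ext
      intro i
      refine Fin.lastCases ?_ (fun j => ?_) i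
      · rw [AlgHom.comp_apply, Ideal.Quotient.mkₐ_eq_mk, Ideal.Quotient.mk_eq_mk_iff_sub_mem,
          Ideal.mem_span_singleton']
        refine ⟨-C (a (Fin.last m))⁻¹, ?_⟩
        simp only [proj, linCoeff_linearForm, AlgHom.comp_apply, aeval_X, Fin.snoc_last, map_sum,
          map_mul, rename_C, rename_X]
        rw [linearForm, Fin.sum_univ_castSucc, mul_add, Finset.mul_sum]
        have h2 : -C (a (Fin.last m))⁻¹ * (C (a (Fin.last m)) * X (Fin.last m)) =
            -(X (Fin.last m) : MvPolynomial (Fin (m + 1)) k) := by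
          rw [← mul_assoc, neg_mul, ← C_mul, inv_mul_cancel₀ ha]
          simp
        rw [h2, sub_eq_add_neg]
        congr 1
        refine Finset.sum_congr rfl fun i _ => ?_
        simp only [map_neg]
        ring
      · simp [proj]
    intro f hf
    have := DFunLike.congr_fun key f
    rw [AlgHom.comp_apply, AlgHom.comp_apply, (RingHom.mem_ker).1 hf] at this
    rw [map_zero, map_zero] at this
    exact Ideal.Quotient.eq_zero_iff_mem.1 this.symm
  · rw [Ideal.span_singleton_le_iff_mem]
    exact proj_self a ha

end HilbertDepth

end

/-!
Let `P_i = P + (l_1, …, l_i)`. If the linear forms are filter-regular modulo `P`, that is, if all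
the modules `(P_i : l_{i+1}) / P_i` have finite length, then the relations
`HS(S/P_{i+1}) = (1 - t) HS(S/P_i) + t HS((P_i : l_{i+1}) / P_i)` accumulate to
`HS(S/P_s) = (1 - t)^s HS(S/P) + G` for a polynomial `G`. The numerators of the two Hilbert series
thus differ by `G (1 - t)^(d - s)`, so that among `e_0, …, e_{d-s}` only `e_{d-s}` can change,
namely by `(-1)^(d-s) G(1)`, where `G(1)` is the length of `(P_{s-1} : l_s) / P_{s-1}`.

Suppose `G(1) = 1`. Present `S/P` over `A = k[y_1, …, y_s]`, with `y_i` acting as `l_i`, on minimal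
homogeneous generators. The module of relations is saturated because `P` is prime, and counting
dimensions degree by degree bounds its rank by `G(1)`. A saturated module of rank at most one over
the factorial ring `A` is cyclic, and a single relation lets only the last form be a zero divisor:
`l_1, …, l_{s-1}` is a regular sequence on `S/P`. On the other hand `(P_{s-1} : l_s) / P_{s-1}` is
nonzero and killed by a power of the irrelevant ideal, so the depth is at most `s - 1`.

General linear forms are filter-regular because the forms with indeterminate coefficients are, and
a complement of the corresponding ideals that is uniform in the coefficients specializes outside a
hypersurface.
-/

noncomputable section

namespace HilbertDepth

section HomogeneousComponents

variable {σ R : Type*} [CommSemiring R]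

attribute [local instance] MvPolynomial.gradedAlgebra in
lemma homogeneousComponent_add_mul {e : ℕ} {l : MvPolynomial σ R} (hl : l.IsHomogeneous e)
    (g : MvPolynomial σ R) (m : ℕ) :
    homogeneousComponent (m + e) (g * l) = homogeneousComponent m g * l := by
  have h := DirectSum.coe_decompose_mul_add_of_right_mem (homogeneousSubmodule σ R) (i := m)
    (a := g) ((mem_homogeneousSubmodule e l).2 hl)
  rwa [← decomposition.decompose'_apply, ← decomposition.decompose'_apply]

attribute [local instance] MvPolynomial.gradedAlgebra in
lemma homogeneousComponent_mul_of_lt {e m : ℕ} {l : MvPolynomial σ R} (hl : l.IsHomogeneous e)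
    (h : m < e) (g : MvPolynomial σ R) : homogeneousComponent m (g * l) = 0 := by
  have h := DirectSum.coe_decompose_mul_of_right_mem_of_not_le (homogeneousSubmodule σ R)
    (a := g) ((mem_homogeneousSubmodule e l).2 hl) h.not_ge
  rwa [← decomposition.decompose'_apply]

end HomogeneousComponents

section HomogeneousIdeals

variable {k : Type*} [Field k] {n : ℕ}

attribute [local instance] MvPolynomial.gradedAlgebra in
lemma isHomogeneousIdeal_iff {I : Ideal (MvPolynomial (Fin n) k)} :
    IsHomogeneousIdeal I ↔ ∀ f ∈ I, ∀ m, homogeneousComponent m f ∈ I := by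
  refine ⟨fun h f hf m => homogeneousComponent_mem_of_mem h hf m, fun h m f hf => ?_⟩
  have := h f hf m
  rwa [← decomposition.decompose'_apply] at this

lemma IsHomogeneousIdeal.colon_singleton {I : Ideal (MvPolynomial (Fin n) k)}
    (hI : IsHomogeneousIdeal I) {e : ℕ} {l : MvPolynomial (Fin n) k} (hl : l.IsHomogeneous e) :
    IsHomogeneousIdeal (I.colon {l}) := by
  rw [isHomogeneousIdeal_iff] at hI ⊢
  simp only [Submodule.mem_colon_singleton, smul_eq_mul]
  intro f hf m
  rw [← homogeneousComponent_add_mul hl]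
  exact hI _ hf _

attribute [local instance] MvPolynomial.gradedAlgebra in
lemma IsHomogeneousIdeal.sup {I J : Ideal (MvPolynomial (Fin n) k)}
    (hI : IsHomogeneousIdeal I) (hJ : IsHomogeneousIdeal J) : IsHomogeneousIdeal (I ⊔ J) :=
  Ideal.IsHomogeneous.sup hI hJ

attribute [local instance] MvPolynomial.gradedAlgebra in
lemma isHomogeneousIdeal_span {s : Set (MvPolynomial (Fin n) k)} {e : ℕ}
    (hs : ∀ l ∈ s, l.IsHomogeneous e) : IsHomogeneousIdeal (Ideal.span s) :=
  Ideal.homogeneous_span _ s fun l hl => ⟨e, hs l hl⟩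

lemma IsHomogeneousIdeal.mem_sup_span_singleton_iff {I : Ideal (MvPolynomial (Fin n) k)}
    (hI : IsHomogeneousIdeal I) {e m : ℕ} {l f : MvPolynomial (Fin n) k}
    (hl : l.IsHomogeneous e) (hf : f.IsHomogeneous (m + e)) :
    f ∈ I ⊔ Ideal.span {l} ↔ ∃ g : MvPolynomial (Fin n) k, g.IsHomogeneous m ∧ f - g * l ∈ I := by
  constructor
  · intro h
    obtain ⟨a, ha, b, hb, hab⟩ := Submodule.mem_sup.1 h
    obtain ⟨c, rfl⟩ := Ideal.mem_span_singleton'.1 hb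
    refine ⟨homogeneousComponent m c, homogeneousComponent_isHomogeneous _ _, ?_⟩
    have : f - homogeneousComponent m c * l = homogeneousComponent (m + e) a := by
      rw [← homogeneousComponent_add_mul hl, sub_eq_iff_eq_add, ← map_add, hab,
        homogeneousComponent_eq_self hf]
    rw [this]
    exact isHomogeneousIdeal_iff.1 hI a ha (m + e)
  · rintro ⟨g, -, h⟩
    rw [← sub_add_cancel f (g * l)]
    exact add_mem (Ideal.mem_sup_left h)
      (Ideal.mem_sup_right (Ideal.mul_mem_left _ _ (Ideal.mem_span_singleton_self l)))

lemma IsHomogeneousIdeal.mem_of_mem_sup_span {I : Ideal (MvPolynomial (Fin n) k)}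
    (hI : IsHomogeneousIdeal I) {e m : ℕ} (hm : m < e) {s : Set (MvPolynomial (Fin n) k)}
    (hs : ∀ l ∈ s, l.IsHomogeneous e) {f : MvPolynomial (Fin n) k} (hf : f.IsHomogeneous m)
    (h : f ∈ I ⊔ Ideal.span s) : f ∈ I := by
  obtain ⟨a, ha, b, hb, rfl⟩ := Submodule.mem_sup.1 h
  have hb0 : homogeneousComponent m b = 0 := by
    obtain ⟨c, t, hts, -, rfl⟩ := Submodule.mem_span_iff_exists_finset_subset.1 hb
    rw [map_sum]
    exact Finset.sum_eq_zero fun l hl => homogeneousComponent_mul_of_lt (hs l (hts hl)) hm _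
  have := isHomogeneousIdeal_iff.1 hI a ha m
  rwa [← homogeneousComponent_eq_self hf, map_add, hb0, add_zero]

end HomogeneousIdeals

section HilbertFunction

variable {k : Type*} [Field k] {n : ℕ}

instance finiteDimensional_homogeneousSubmodule (m : ℕ) :
    FiniteDimensional k (homogeneousSubmodule (Fin n) k m) :=
  Module.Finite.iff_fg.2 (homogeneousSubmodule_fg (Fin n) k m)

lemma finrank_map_add_finrank_inf_ker {V W : Type*} [AddCommGroup V] [Module k V]
    [AddCommGroup W] [Module k W] (f : V →ₗ[k] W) (U : Submodule k V) [FiniteDimensional k U] :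
    Module.finrank k (U.map f) + Module.finrank k (U ⊓ LinearMap.ker f : Submodule k V) =
      Module.finrank k U := by
  have h := LinearMap.finrank_range_add_finrank_ker (f.domRestrict U)
  rwa [LinearMap.range_domRestrict, LinearMap.ker_domRestrict,
    LinearEquiv.finrank_eq (Submodule.equivMapOfInjective _ U.injective_subtype _),
    Submodule.map_comap_subtype] at h

lemma hilbertFunction_add_finrank (I : Ideal (MvPolynomial (Fin n) k)) (m : ℕ) :
    hilbertFunction I m + Module.finrank k
      (homogeneousSubmodule (Fin n) k m ⊓ I.restrictScalars k : Submodule k _) =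
      Module.finrank k (homogeneousSubmodule (Fin n) k m) := by
  have hker : LinearMap.ker (Ideal.Quotient.mkₐ k I).toLinearMap = I.restrictScalars k := by
    ext f
    simp [Ideal.Quotient.eq_zero_iff_mem]
  rw [hilbertFunction, ← hker]
  exact finrank_map_add_finrank_inf_ker _ _

lemma hilbertFunction_congr {I J : Ideal (MvPolynomial (Fin n) k)} {m : ℕ}
    (h : ∀ f : MvPolynomial (Fin n) k, f.IsHomogeneous m → (f ∈ I ↔ f ∈ J)) :
    hilbertFunction I m = hilbertFunction J m := by
  have hIJ : (homogeneousSubmodule (Fin n) k m ⊓ I.restrictScalars k : Submodule k _) =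
      (homogeneousSubmodule (Fin n) k m ⊓ J.restrictScalars k : Submodule k _) :=
    SetLike.ext fun f => and_congr_right (h f)
  have hI := hilbertFunction_add_finrank I m
  rw [hIJ, ← hilbertFunction_add_finrank J m] at hI
  exact Nat.add_right_cancel hI

lemma hilbertFunction_eq_zero {I : Ideal (MvPolynomial (Fin n) k)} {m : ℕ}
    (h : ∀ f : MvPolynomial (Fin n) k, f.IsHomogeneous m → f ∈ I) : hilbertFunction I m = 0 := by
  have hI := hilbertFunction_add_finrank I m
  rwa [show (homogeneousSubmodule (Fin n) k m ⊓ I.restrictScalars k : Submodule k _) =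
    homogeneousSubmodule (Fin n) k m from inf_eq_left.2 fun f hf => h f hf,
    Nat.add_eq_right] at hI

lemma map_homogeneousSubmodule_mulRight {I : Ideal (MvPolynomial (Fin n) k)}
    (hI : IsHomogeneousIdeal I) {e : ℕ} {l : MvPolynomial (Fin n) k} (hl : l.IsHomogeneous e)
    (m : ℕ) :
    (homogeneousSubmodule (Fin n) k m).map
        ((Ideal.Quotient.mkₐ k I).toLinearMap ∘ₗ LinearMap.mulRight k l) =
      (homogeneousSubmodule (Fin n) k (m + e) ⊓
        (I ⊔ Ideal.span {l}).restrictScalars k).map (Ideal.Quotient.mkₐ k I).toLinearMap := by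
  ext x
  simp only [Submodule.mem_map]
  constructor
  · rintro ⟨g, hg, rfl⟩
    exact ⟨g * l, ⟨hg.mul hl, Ideal.mem_sup_right
      (Ideal.mul_mem_left _ _ (Ideal.mem_span_singleton_self l))⟩, rfl⟩
  · rintro ⟨f, ⟨hf, hfK⟩, rfl⟩
    obtain ⟨g, hg, hfg⟩ := (hI.mem_sup_span_singleton_iff hl hf).1 hfK
    exact ⟨g, hg, (Ideal.Quotient.eq.2 hfg).symm⟩

lemma hilbertFunction_add_degree {I : Ideal (MvPolynomial (Fin n) k)}
    (hI : IsHomogeneousIdeal I) {e : ℕ} {l : MvPolynomial (Fin n) k} (hl : l.IsHomogeneous e)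
    (m : ℕ) : hilbertFunction I (m + e) =
      hilbertFunction (I.colon {l}) m + hilbertFunction (I ⊔ Ideal.span {l}) (m + e) := by
  set q := (Ideal.Quotient.mkₐ k I).toLinearMap
  set K := I ⊔ Ideal.span {l}
  set U := homogeneousSubmodule (Fin n) k (m + e) ⊓ K.restrictScalars k
  have himg : (homogeneousSubmodule (Fin n) k m).map (q ∘ₗ LinearMap.mulRight k l) = U.map q :=
    map_homogeneousSubmodule_mulRight hI hl m
  have hker_mul : LinearMap.ker (q ∘ₗ LinearMap.mulRight k l) =
      (I.colon {l}).restrictScalars k := by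
    ext f
    simp only [q, LinearMap.mem_ker, LinearMap.comp_apply, LinearMap.mulRight_apply,
      AlgHom.toLinearMap_apply, Ideal.Quotient.mkₐ_eq_mk, Ideal.Quotient.eq_zero_iff_mem,
      Submodule.restrictScalars_mem, Submodule.mem_colon_singleton, smul_eq_mul]
  have hker : U ⊓ LinearMap.ker q =
      homogeneousSubmodule (Fin n) k (m + e) ⊓ I.restrictScalars k := by
    ext f
    simp only [U, K, q, Submodule.mem_inf, Submodule.restrictScalars_mem, LinearMap.mem_ker,
      AlgHom.toLinearMap_apply, Ideal.Quotient.mkₐ_eq_mk, Ideal.Quotient.eq_zero_iff_mem]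
    exact ⟨fun h => ⟨h.1.1, h.2⟩, fun h => ⟨⟨h.1, Ideal.mem_sup_left h.2⟩, h.2⟩⟩
  have hmul := finrank_map_add_finrank_inf_ker (q ∘ₗ LinearMap.mulRight k l)
    (homogeneousSubmodule (Fin n) k m)
  rw [himg, hker_mul] at hmul
  have hU := finrank_map_add_finrank_inf_ker q U
  rw [hker] at hU
  have hIm := hilbertFunction_add_finrank I (m + e)
  have hKm : hilbertFunction K (m + e) + Module.finrank k U = _ :=
    hilbertFunction_add_finrank K (m + e)
  have hcm := hilbertFunction_add_finrank (I.colon {l}) m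
  omega

lemma hilbertSeries_eq_X_mul_colon_add_sup {I : Ideal (MvPolynomial (Fin n) k)}
    (hI : IsHomogeneousIdeal I) {l : MvPolynomial (Fin n) k} (hl : l.IsHomogeneous 1) :
    hilbertSeries I = PowerSeries.X * hilbertSeries (I.colon {l}) +
      hilbertSeries (I ⊔ Ideal.span {l}) := by
  ext (_ | m)
  · have : hilbertFunction I 0 = hilbertFunction (I ⊔ Ideal.span {l}) 0 :=
      hilbertFunction_congr fun f hf => ⟨fun h => Ideal.mem_sup_left h,
        hI.mem_of_mem_sup_span one_pos (by simpa using hl) hf⟩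
    simp [hilbertSeries, this]
  · simp [hilbertSeries, hilbertFunction_add_degree hI hl m, PowerSeries.coeff_succ_X_mul]

end HilbertFunction

section PowerSeries

lemma mk_sum_range_mul_one_sub_X {R : Type*} [Ring R] (f : ℕ → R) :
    (PowerSeries.mk fun m => ∑ j ∈ Finset.range (m + 1), f j) * (1 - PowerSeries.X) =
      PowerSeries.mk f := by
  ext (_ | m)
  · simp
  · rw [mul_sub, mul_one, map_sub, PowerSeries.coeff_succ_mul_X]
    simp [Finset.sum_range_succ _ (m + 1)]

lemma eventually_coeff_neg_of_mul_one_sub_X {A : PowerSeries ℤ}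
    (h : ∀ᶠ m in Filter.atTop, PowerSeries.coeff m (A * (1 - PowerSeries.X)) < 0) :
    ∀ᶠ m in Filter.atTop, PowerSeries.coeff m A < 0 := by
  obtain ⟨N, hN⟩ := Filter.eventually_atTop.1 h
  have hlin : ∀ j : ℕ, PowerSeries.coeff (N + j) A ≤ PowerSeries.coeff N A - j := by
    intro j
    induction j with
    | zero => simp
    | succ j ih =>
      have hstep := hN (N + j + 1) (by omega)
      rw [mul_sub, mul_one, map_sub, PowerSeries.coeff_succ_mul_X] at hstep
      push_cast
      rw [← add_assoc]
      linarith
  refine Filter.eventually_atTop.2 ⟨N + (PowerSeries.coeff N A + 1).toNat, fun m hm => ?_⟩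
  obtain ⟨j, rfl⟩ := Nat.exists_eq_add_of_le (Nat.le_of_add_right_le hm)
  have := hlin j
  omega

lemma eventually_coeff_neg_of_mul_one_sub_X_pow {A : PowerSeries ℤ} (D : ℕ)
    (h : ∀ᶠ m in Filter.atTop, PowerSeries.coeff m (A * (1 - PowerSeries.X) ^ D) < 0) :
    ∀ᶠ m in Filter.atTop, PowerSeries.coeff m A < 0 := by
  induction D with
  | zero => simpa using h
  | succ D ih =>
    rw [pow_succ, ← mul_assoc] at h
    exact ih (eventually_coeff_neg_of_mul_one_sub_X h)

lemma eval_one_nonneg_of_coeff_nonneg {g : Polynomial ℤ} {D : ℕ} {H : PowerSeries ℤ}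
    (hH : H * (1 - PowerSeries.X) ^ D = (g : PowerSeries ℤ))
    (hpos : ∀ m, 0 ≤ PowerSeries.coeff m H) : 0 ≤ g.eval 1 := by
  by_contra! hneg
  -- The coefficients of `H / (1 - X)` are nonnegative, and those of `g / (1 - X)` end in `g(1)`.
  have hcoe : PowerSeries.mk (PowerSeries.coeff · H) = H := PowerSeries.ext fun m => by simp
  have hsum : (PowerSeries.mk fun m => ∑ j ∈ Finset.range (m + 1), PowerSeries.coeff j H) *
      (1 - PowerSeries.X) ^ D = PowerSeries.mk fun m => ∑ j ∈ Finset.range (m + 1), g.coeff j := by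
    have hreg : IsUnit (1 - PowerSeries.X : PowerSeries ℤ) := by
      simp [PowerSeries.isUnit_iff_constantCoeff]
    refine hreg.mul_left_injective ?_
    simp only
    rw [mul_right_comm, mk_sum_range_mul_one_sub_X, mk_sum_range_mul_one_sub_X, hcoe, hH]
    ext m
    simp
  have heventually := eventually_coeff_neg_of_mul_one_sub_X_pow D <|
    Filter.eventually_atTop.2 ⟨g.natDegree, fun m hm => by
      rw [hsum, PowerSeries.coeff_mk]
      rw [Polynomial.eval_eq_sum_range' (Nat.lt_succ_of_le hm)] at hneg
      simpa using hneg⟩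
  obtain ⟨m, hm⟩ := heventually.exists
  rw [PowerSeries.coeff_mk] at hm
  exact hm.not_ge (Finset.sum_nonneg fun j _ => hpos j)

lemma mk_multichoose_mul_one_sub_X_pow (s : ℕ) :
    (PowerSeries.mk fun m => (Nat.multichoose s m : ℤ)) * (1 - PowerSeries.X) ^ s = 1 := by
  cases s with
  | zero =>
    ext (_ | m)
    · simp
    · simp [PowerSeries.coeff_one]
  | succ s =>
    convert PowerSeries.mk_add_choose_mul_one_sub_pow_eq_one ℤ s using 4 with m
    rw [Nat.multichoose_eq, show s + 1 + m - 1 = s + m by omega, Nat.choose_symm_add]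

lemma coe_trunc_mk_of_eventually_zero {R : Type*} [Semiring R] (f : ℕ → R) (N : ℕ)
    (h : ∀ m, N ≤ m → f m = 0) :
    (((PowerSeries.mk f).trunc N : Polynomial R) : PowerSeries R) = PowerSeries.mk f := by
  ext m
  rw [Polynomial.coeff_coe, PowerSeries.coeff_trunc]
  split_ifs with hm
  · rfl
  · simp [h m (not_lt.1 hm)]

end PowerSeries

section Irrelevant

variable {k : Type*} [Field k] {n : ℕ}

/-- The quotient `S / I` has finite length: the variables lie in the radical of `I`. The unit ideal
is included. -/
def IsIrrelevant (I : Ideal (MvPolynomial (Fin n) k)) : Prop :=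
  ∀ j, X j ∈ I.radical

lemma IsIrrelevant.mono {I J : Ideal (MvPolynomial (Fin n) k)} (hI : IsIrrelevant I)
    (h : I ≤ J) : IsIrrelevant J := fun j => Ideal.radical_mono h (hI j)

lemma IsIrrelevant.exists_pow_idealOfVars_le {I : Ideal (MvPolynomial (Fin n) k)}
    (hI : IsIrrelevant I) : ∃ N, idealOfVars (Fin n) k ^ N ≤ I := by
  refine Ideal.exists_pow_le_of_le_radical_of_fg (Ideal.span_le.2 ?_) (idealOfVars_fg _ _)
  rintro _ ⟨j, rfl⟩
  exact hI j

lemma mem_pow_idealOfVars_of_isHomogeneous {σ R : Type*} [CommSemiring R] {f : MvPolynomial σ R}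
    {m N : ℕ} (hf : f.IsHomogeneous m) (h : N ≤ m) : f ∈ idealOfVars σ R ^ N := by
  rw [mem_pow_idealOfVars_iff']
  intro x hx
  exact hf.coeff_eq_zero (by omega)

lemma exists_forall_mem_of_torsion {I K : Ideal (MvPolynomial (Fin n) k)}
    (h : ∀ f ∈ K, IsIrrelevant (I.colon {f})) :
    ∃ N, ∀ m, N ≤ m → ∀ f : MvPolynomial (Fin n) k, f.IsHomogeneous m → f ∈ K → f ∈ I := by
  set 𝔪 := idealOfVars (Fin n) k
  obtain ⟨N, hN⟩ : ∃ N, 𝔪 ^ N ≤ I.colon K := by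
    obtain ⟨t, rfl⟩ : K.FG := IsNoetherian.noetherian K
    have hgen : ∀ g ∈ t, ∃ N, 𝔪 ^ N ≤ I.colon {g} := fun g hg =>
      (h g (Submodule.subset_span hg)).exists_pow_idealOfVars_le
    choose! N hN using hgen
    refine ⟨t.sup N, fun r hr => ?_⟩
    rw [Submodule.colon_span, Submodule.mem_colon]
    exact fun g hg => Submodule.mem_colon_singleton.1
      (hN g hg (Ideal.pow_le_pow_right (Finset.le_sup hg) hr))
  obtain ⟨c, hc⟩ := Ideal.exists_pow_inf_eq_pow_smul 𝔪 K
  refine ⟨N + c, fun m hm f hf hfK => ?_⟩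
  have hartinRees : f ∈ 𝔪 ^ (m - c) • (𝔪 ^ c • ⊤ ⊓ K) := by
    rw [← hc m (by omega)]
    exact ⟨by simpa using mem_pow_idealOfVars_of_isHomogeneous hf le_rfl, hfK⟩
  refine Submodule.smul_le.2 (fun r hr g hg => ?_) hartinRees
  exact Submodule.mem_colon.1 (hN (Ideal.pow_le_pow_right (by omega) hr)) g hg.2

lemma IsIrrelevant.exists_polynomial_eq_hilbertSeries {I : Ideal (MvPolynomial (Fin n) k)}
    (hI : IsIrrelevant I) : ∃ q : Polynomial ℤ, (q : PowerSeries ℤ) = hilbertSeries I := by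
  obtain ⟨N, hN⟩ := hI.exists_pow_idealOfVars_le
  refine ⟨_, coe_trunc_mk_of_eventually_zero _ N fun m hm => ?_⟩
  rw [hilbertFunction_eq_zero fun f hf => hN (mem_pow_idealOfVars_of_isHomogeneous hf hm),
    Nat.cast_zero]

end Irrelevant

section HilbertSerre

variable {k : Type*} [Field k] {n : ℕ}

lemma sup_span_singleton_sup_span_range_succ {R : Type*} [CommRing R] (I : Ideal R) {D : ℕ}
    (y : Fin (D + 1) → R) :
    I ⊔ Ideal.span {y 0} ⊔ Ideal.span (Set.range fun j : Fin D => y j.succ) =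
      I ⊔ Ideal.span (Set.range y) := by
  rw [sup_assoc, ← Ideal.span_union, Fin.range_fin_succ, Set.insert_eq]
  rfl

theorem exists_polynomial_eq_hilbertSeries_mul {D : ℕ} {I : Ideal (MvPolynomial (Fin n) k)}
    (hI : IsHomogeneousIdeal I) {y : Fin D → MvPolynomial (Fin n) k}
    (hy : ∀ j, (y j).IsHomogeneous 1) (h : IsIrrelevant (I ⊔ Ideal.span (Set.range y))) :
    ∃ q : Polynomial ℤ, (q : PowerSeries ℤ) = hilbertSeries I * (1 - PowerSeries.X) ^ D := by
  induction D generalizing I with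
  | zero => simpa [Set.range_eq_empty] using h.exists_polynomial_eq_hilbertSeries
  | succ D ihD =>
    induction I using IsNoetherian.induction with
    | hgt I ihI =>
    obtain ⟨q, hq⟩ := ihD (hI.sup (isHomogeneousIdeal_span (s := {y 0}) (by simpa using hy 0)))
      (y := fun j => y j.succ) (fun j => hy _)
      (by rwa [sup_span_singleton_sup_span_range_succ])
    have hseries := hilbertSeries_eq_X_mul_colon_add_sup hI (hy 0)
    rcases (Ideal.le_colon (I := I) (S := {y 0})).eq_or_lt with hcolon | hlt
    · rw [← hcolon] at hseries
      refine ⟨q, ?_⟩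
      rw [hq, pow_succ']
      linear_combination (-(1 - PowerSeries.X) ^ D) * hseries
    · obtain ⟨q', hq'⟩ := ihI _ hlt (hI.colon_singleton (hy 0)) (h.mono (sup_le_sup_right hlt.le _))
      refine ⟨Polynomial.X * q' + q * (1 - Polynomial.X), ?_⟩
      rw [hseries]
      push_cast
      rw [hq, hq']
      ring

lemma IsHomogeneousIdeal.exists_sub_sum_mul_mem {I : Ideal (MvPolynomial (Fin n) k)}
    (hI : IsHomogeneousIdeal I) {D e m : ℕ} {y : Fin D → MvPolynomial (Fin n) k}
    (hy : ∀ j, (y j).IsHomogeneous e) {f : MvPolynomial (Fin n) k} (hf : f.IsHomogeneous (m + e))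
    (h : f ∈ I ⊔ Ideal.span (Set.range y)) :
    ∃ c : Fin D → MvPolynomial (Fin n) k, (∀ j, (c j).IsHomogeneous m) ∧
      f - ∑ j, c j * y j ∈ I := by
  obtain ⟨a, ha, b, hb, rfl⟩ := Submodule.mem_sup.1 h
  obtain ⟨c, rfl⟩ := (Submodule.mem_span_range_iff_exists_fun _).1 hb
  refine ⟨fun j => homogeneousComponent m (c j),
    fun j => homogeneousComponent_isHomogeneous _ _, ?_⟩
  have hcomp := homogeneousComponent_eq_self hf
  simp only [map_add, map_sum, smul_eq_mul, fun j => homogeneousComponent_add_mul (hy j)] at hcomp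
  simp only [← hcomp, smul_eq_mul, add_sub_cancel_right]
  exact isHomogeneousIdeal_iff.1 hI a ha _

lemma graded_nakayama {I : Ideal (MvPolynomial (Fin n) k)} (hI : IsHomogeneousIdeal I) {D : ℕ}
    {y : Fin D → MvPolynomial (Fin n) k} (hy : ∀ j, (y j).IsHomogeneous 1)
    (M : ℕ → Submodule k (MvPolynomial (Fin n) k))
    (hIM : ∀ m f, f ∈ I → f.IsHomogeneous m → f ∈ M m)
    (hyM : ∀ m j f, f ∈ M m → f * y j ∈ M (m + 1))
    (h : ∀ m f, f.IsHomogeneous m →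
      ∃ t ∈ M m, t.IsHomogeneous m ∧ f - t ∈ I ⊔ Ideal.span (Set.range y)) :
    ∀ m f, f.IsHomogeneous m → f ∈ M m := by
  intro m
  induction m with
  | zero =>
    intro f hf
    obtain ⟨t, ht, htm, hft⟩ := h 0 f hf
    rw [← sub_add_cancel f t]
    exact add_mem (hIM _ _ (hI.mem_of_mem_sup_span one_pos (Set.forall_mem_range.2 hy)
      (hf.sub htm) hft) (hf.sub htm)) ht
  | succ m ih =>
    intro f hf
    obtain ⟨t, ht, htm, hft⟩ := h (m + 1) f hf
    obtain ⟨c, hc, hfc⟩ := hI.exists_sub_sum_mul_mem hy (hf.sub htm) hft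
    have hsum : (∑ j, c j * y j).IsHomogeneous (m + 1) :=
      IsHomogeneous.sum _ _ _ fun j _ => (hc j).mul (hy j)
    rw [← sub_add_cancel f t, ← sub_add_cancel (f - t) (∑ j, c j * y j)]
    exact add_mem (add_mem (hIM _ _ hfc ((hf.sub htm).sub hsum))
      (sum_mem fun j _ => hyM _ _ _ (ih _ (hc j)))) ht

end HilbertSerre

lemma ringKrullDim_eq_of_isIntegral_of_injective {R A : Type*} [CommRing R] [CommRing A]
    [Algebra R A] [Algebra.IsIntegral R A] (hinj : Function.Injective (algebraMap R A)) :
    ringKrullDim A = ringKrullDim R := by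
  apply le_antisymm
  · exact Order.krullDim_le_of_strictMono (PrimeSpectrum.comap (algebraMap R A))
      fun p q hpq => Ideal.IsIntegral.comap_lt_comap (R := R) (I := p.asIdeal) (J := q.asIdeal) hpq
  · have : FaithfulSMul R A := (faithfulSMul_iff_algebraMap_injective R A).2 hinj
    refine iSup_le fun chain => ?_
    obtain ⟨p, hp⟩ := Algebra.IsIntegral.comap_surjective R A chain.head
    have : p.asIdeal.LiesOver (RelSeries.head chain).asIdeal := ⟨by rw [← hp]; rfl⟩
    obtain ⟨lift, hlift, -⟩ := Ideal.exists_ltSeries_of_hasGoingUp chain p.asIdeal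
    rw [← hlift]
    exact le_iSup (fun L : LTSeries (PrimeSpectrum A) => (L.length : WithBot ℕ∞)) lift

section Noether

variable {k : Type*} [Field k] {n : ℕ}

lemma homogeneousComponent_aeval {R σ τ : Type*} [CommSemiring R] {y : σ → MvPolynomial τ R}
    (hy : ∀ j, (y j).IsHomogeneous 1) (f : MvPolynomial σ R) (e : ℕ) :
    homogeneousComponent e (aeval y f) = aeval y (homogeneousComponent e f) := by
  classical
  have key : ∀ i, homogeneousComponent e (aeval y (homogeneousComponent i f)) =
      if e = i then aeval y (homogeneousComponent i f) else 0 := by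
    intro i
    have h := (homogeneousComponent_isHomogeneous i f).aeval y hy
    rw [one_mul] at h
    rw [homogeneousComponent_of_mem h]
  conv_lhs => rw [← sum_homogeneousComponent f, map_sum, map_sum]
  rw [Finset.sum_congr rfl fun i _ => key i, Finset.sum_ite_eq]
  split_ifs with h
  · rfl
  · rw [homogeneousComponent_eq_zero e f (by simpa using h), map_zero]

lemma aeval_smul_of_isHomogeneous {R σ A : Type*} [CommSemiring R] [CommSemiring A] [Algebra R A]
    {e : ℕ} {F : MvPolynomial σ R} (hF : F.IsHomogeneous e) (b : σ → R) (z : A) :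
    aeval (fun j => b j • z) F = eval b F • z ^ e := by
  rw [aeval_def, eval₂_eq, eval_eq, Finset.sum_smul]
  refine Finset.sum_congr rfl fun d hd => ?_
  have hdeg : ∑ i ∈ d.support, d i = e := (hF.degree_eq_sum_deg_support hd).symm
  simp only [smul_pow, Finset.prod_smul, Finset.prod_pow_eq_pow_sum, hdeg, ← Algebra.smul_def,
    mul_smul]

lemma mem_radical_of_aeval_mem {σ A : Type*} [CommRing A] [Algebra k A] {J : Ideal A} {e : ℕ}
    {F : MvPolynomial σ k} (hF : F.IsHomogeneous e) {y : σ → A} (hFJ : aeval y F ∈ J)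
    {c : σ → k} (hc : eval c F ≠ 0) {z : A} (hyz : ∀ j, y j - c j • z ∈ J) (j : σ) :
    y j ∈ J.radical := by
  have hmk : ∀ j, Ideal.Quotient.mkₐ k J (y j) = c j • Ideal.Quotient.mkₐ k J z := fun j => by
    rw [← map_smul]
    exact Ideal.Quotient.eq.2 (hyz j)
  have hzero : eval c F • Ideal.Quotient.mkₐ k J z ^ e = 0 := by
    rw [← aeval_smul_of_isHomogeneous hF]
    simp_rw [← hmk]
    rw [← comp_aeval_apply]
    exact Ideal.Quotient.eq_zero_iff_mem.2 hFJ
  have hz : z ∈ J.radical := by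
    refine ⟨e, Ideal.Quotient.eq_zero_iff_mem.1 ?_⟩
    rw [map_pow]
    exact (smul_eq_zero_iff_right hc).1 hzero
  rw [← sub_add_cancel (y j) (c j • z)]
  exact add_mem (Ideal.le_radical (hyz j)) (Submodule.smul_of_tower_mem _ _ hz)

/-- Linear forms `y` that generate an ideal of finite colength in `S / I`: a homogeneous system of
parameters of degree one, except that no minimality of their number is required. -/
structure IsParam (I : Ideal (MvPolynomial (Fin n) k)) {D : ℕ}
    (y : Fin D → MvPolynomial (Fin n) k) : Prop where
  isHomogeneous : ∀ j, (y j).IsHomogeneous 1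
  isIrrelevant : IsIrrelevant (I ⊔ Ideal.span (Set.range y))

lemma isParam_X (I : Ideal (MvPolynomial (Fin n) k)) : IsParam I X :=
  ⟨fun j => isHomogeneous_X k j, fun j =>
    Ideal.le_radical (Ideal.mem_sup_right (Ideal.subset_span ⟨j, rfl⟩))⟩

lemma exists_eval_ne_zero_of_aeval_mem [Infinite k] {I : Ideal (MvPolynomial (Fin n) k)}
    (hne : I ≠ ⊤) {D e : ℕ} {y : Fin D → MvPolynomial (Fin n) k} {F : MvPolynomial (Fin D) k}
    (hF : F.IsHomogeneous e) (hF0 : F ≠ 0) (hFI : aeval y F ∈ I) :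
    ∃ c, eval c F ≠ 0 ∧ ∃ j, c j ≠ 0 := by
  obtain ⟨c, hc⟩ : ∃ c, eval c F ≠ 0 := by
    by_contra! h
    exact hF0 (MvPolynomial.funext fun x => by rw [h x, map_zero])
  refine ⟨c, hc, ?_⟩
  by_contra! hc0
  rw [show c = 0 from funext hc0, eval_zero, constantCoeff_eq] at hc
  obtain rfl : 0 = e := by simpa using hF hc
  obtain ⟨a, rfl⟩ : ∃ a, F = C a :=
    ⟨_, totalDegree_eq_zero_iff_eq_C.1 (Nat.le_zero.1 hF.totalDegree_le)⟩
  rw [algHom_C] at hFI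
  exact hne (Ideal.eq_top_of_isUnit_mem _ hFI ((IsUnit.mk0 a (by simpa using hc)).map _))

/-- A relation `F(y) ∈ I` with `F(c) ≠ 0` and `c_{j₀} ≠ 0` makes the projections of the `y_j` along
`c` from the point `y_{j₀}` a system of one form less. -/
lemma IsParam.exists_of_aeval_mem {I : Ideal (MvPolynomial (Fin n) k)} {D e : ℕ}
    {y : Fin (D + 1) → MvPolynomial (Fin n) k} (hy : IsParam I y)
    {F : MvPolynomial (Fin (D + 1)) k} (hF : F.IsHomogeneous e) (hFI : aeval y F ∈ I)
    {c : Fin (D + 1) → k} (hc : eval c F ≠ 0) {j₀ : Fin (D + 1)} (hj₀ : c j₀ ≠ 0) :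
    ∃ y' : Fin D → MvPolynomial (Fin n) k, IsParam I y' := by
  set z := (c j₀)⁻¹ • y j₀
  set y' : Fin D → MvPolynomial (Fin n) k := fun j => y (j₀.succAbove j) - c (j₀.succAbove j) • z
  set J := I ⊔ Ideal.span (Set.range y')
  have hyz : ∀ j, y j - c j • z ∈ J := by
    refine j₀.succAboveCases ?_ fun i => Ideal.mem_sup_right (Ideal.subset_span ⟨i, rfl⟩)
    simp only [z, smul_inv_smul₀ hj₀, sub_self, zero_mem]
  have hle : I ⊔ Ideal.span (Set.range y) ≤ J.radical :=
    sup_le (le_sup_left.trans Ideal.le_radical) (Ideal.span_le.2 (Set.range_subset_iff.2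
      (mem_radical_of_aeval_mem hF (Ideal.mem_sup_left hFI) hc hyz)))
  refine ⟨y', fun j => (hy.isHomogeneous _).sub ?_, fun j => ?_⟩
  · simpa only [z, smul_eq_C_mul] using ((hy.isHomogeneous j₀).C_mul _).C_mul _
  · simpa only [Ideal.radical_idem] using Ideal.radical_mono hle (hy.isIrrelevant j)

theorem IsParam.injective_of_minimal [Infinite k] {I : Ideal (MvPolynomial (Fin n) k)}
    (hI : IsHomogeneousIdeal I) (hne : I ≠ ⊤) {D : ℕ} {y : Fin D → MvPolynomial (Fin n) k}
    (hy : IsParam I y)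
    (hmin : ∀ D' < D, ∀ y' : Fin D' → MvPolynomial (Fin n) k, ¬ IsParam I y')
    {f : MvPolynomial (Fin D) k} (hf : aeval y f ∈ I) : f = 0 := by
  by_contra hf0
  obtain ⟨e, he⟩ : ∃ e, homogeneousComponent e f ≠ 0 := by
    by_contra! h
    exact hf0 ((sum_homogeneousComponent f).symm.trans (Finset.sum_eq_zero fun i _ => h i))
  have hF := homogeneousComponent_isHomogeneous e f
  have hFI : aeval y (homogeneousComponent e f) ∈ I := by
    rw [← homogeneousComponent_aeval hy.isHomogeneous]
    exact isHomogeneousIdeal_iff.1 hI _ hf e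
  obtain ⟨c, hc, j₀, hj₀⟩ := exists_eval_ne_zero_of_aeval_mem hne hF he hFI
  obtain _ | D := D
  · exact j₀.elim0
  · obtain ⟨y', hy'⟩ := hy.exists_of_aeval_mem hF hFI hc hj₀
    exact hmin D D.lt_succ_self y' hy'

lemma mem_of_isHomogeneous_of_monomial_mem {R σ : Type*} [CommSemiring R]
    {M : Submodule R (MvPolynomial σ R)} {m : ℕ}
    (hM : ∀ α : σ →₀ ℕ, α.degree = m → monomial α 1 ∈ M) {f : MvPolynomial σ R}
    (hf : f.IsHomogeneous m) : f ∈ M := by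
  rw [f.as_sum]
  refine sum_mem fun α hα => ?_
  rw [← mul_one (coeff α f), ← smul_eq_mul, ← smul_monomial]
  refine M.smul_mem _ (hM α ?_)
  by_contra h
  exact (mem_support_iff.1 hα) (hf.coeff_eq_zero h)

theorem IsParam.finite {I : Ideal (MvPolynomial (Fin n) k)} (hI : IsHomogeneousIdeal I) {D : ℕ}
    {y : Fin D → MvPolynomial (Fin n) k} (hy : IsParam I y) :
    ((Ideal.Quotient.mkₐ k I).comp (aeval y)).toRingHom.Finite := by
  set φ := (Ideal.Quotient.mkₐ k I).comp (aeval y)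
  let _ : Algebra (MvPolynomial (Fin D) k) (MvPolynomial (Fin n) k ⧸ I) := φ.toRingHom.toAlgebra
  let _ : Module (MvPolynomial (Fin D) k) (MvPolynomial (Fin n) k ⧸ I) := Algebra.toModule
  have : IsScalarTower k (MvPolynomial (Fin D) k) (MvPolynomial (Fin n) k ⧸ I) :=
    .of_algebraMap_eq' φ.comp_algebraMap.symm
  obtain ⟨N, hN⟩ := hy.isIrrelevant.exists_pow_idealOfVars_le
  set T : Set (MvPolynomial (Fin n) k ⧸ I) :=
    (fun α => Ideal.Quotient.mk I (monomial α 1)) '' {α : Fin n →₀ ℕ | α.degree ≤ N}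
  set M : Submodule k (MvPolynomial (Fin n) k) :=
    ((Submodule.span (MvPolynomial (Fin D) k) T).restrictScalars k).comap
      (Ideal.Quotient.mkₐ k I).toLinearMap
  have hM : ∀ m f, f.IsHomogeneous m → f ∈ M := by
    refine graded_nakayama hI hy.isHomogeneous (fun _ => M) (fun _ f hf _ => ?_)
      (fun _ j f hf => ?_) fun m f hf => ?_
    · have h0 : (Ideal.Quotient.mkₐ k I).toLinearMap f = 0 := Ideal.Quotient.eq_zero_iff_mem.2 hf
      rw [Submodule.mem_comap, h0]
      exact zero_mem _
    · have hsmul : Ideal.Quotient.mk I (f * y j) =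
          (X j : MvPolynomial (Fin D) k) • Ideal.Quotient.mk I f := by
        rw [Algebra.smul_def, mul_comm f, map_mul]
        exact congrArg (· * _) (congrArg _ (aeval_X y j).symm)
      exact (congrArg (· ∈ Submodule.span _ T) hsmul).mpr (Submodule.smul_mem _ (X j) hf)
    · rcases lt_or_ge m N with hm | hm
      · refine ⟨f, mem_of_isHomogeneous_of_monomial_mem (fun α hα => ?_) hf, hf, by simp⟩
        exact Submodule.subset_span ⟨α, (hα.trans_lt hm).le, rfl⟩
      · refine ⟨0, zero_mem _, isHomogeneous_zero _ _ _, ?_⟩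
        rw [sub_zero]
        exact hN (mem_pow_idealOfVars_of_isHomogeneous hf hm)
  have hT : T.Finite := (Finsupp.finite_of_degree_le N).image _
  refine ⟨⟨hT.toFinset, ?_⟩⟩
  rw [Set.Finite.coe_toFinset, eq_top_iff]
  rintro x -
  obtain ⟨f, rfl⟩ := Ideal.Quotient.mk_surjective x
  rw [← sum_homogeneousComponent f]
  exact (sum_mem fun i _ => hM i _ (homogeneousComponent_isHomogeneous i f) : _ ∈ M)

theorem IsParam.ringKrullDim_eq {I : Ideal (MvPolynomial (Fin n) k)} (hI : IsHomogeneousIdeal I)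
    {D : ℕ} {y : Fin D → MvPolynomial (Fin n) k} (hy : IsParam I y)
    (hinj : ∀ f : MvPolynomial (Fin D) k, aeval y f ∈ I → f = 0) :
    ringKrullDim (MvPolynomial (Fin n) k ⧸ I) = D := by
  set φ := (Ideal.Quotient.mkₐ k I).comp (aeval y)
  let _ : Algebra (MvPolynomial (Fin D) k) (MvPolynomial (Fin n) k ⧸ I) := φ.toRingHom.toAlgebra
  have : Algebra.IsIntegral (MvPolynomial (Fin D) k) (MvPolynomial (Fin n) k ⧸ I) :=
    ⟨(hy.finite hI).to_isIntegral⟩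
  rw [ringKrullDim_eq_of_isIntegral_of_injective (R := MvPolynomial (Fin D) k)]
  · simp
  · exact (injective_iff_map_eq_zero φ.toRingHom).2 fun f hf =>
      hinj f (Ideal.Quotient.eq_zero_iff_mem.1 hf)

theorem exists_isParam [Infinite k] {I : Ideal (MvPolynomial (Fin n) k)}
    (hI : IsHomogeneousIdeal I) (hne : I ≠ ⊤) :
    ∃ D : ℕ, ringKrullDim (MvPolynomial (Fin n) k ⧸ I) = D ∧
      (∃ y : Fin D → MvPolynomial (Fin n) k, IsParam I y ∧
        ∀ f : MvPolynomial (Fin D) k, aeval y f ∈ I → f = 0) ∧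
      ∀ D' < D, ∀ y' : Fin D' → MvPolynomial (Fin n) k, ¬ IsParam I y' := by
  classical
  have hex : ∃ D, ∃ y : Fin D → MvPolynomial (Fin n) k, IsParam I y := ⟨n, _, isParam_X I⟩
  obtain ⟨y, hy⟩ := Nat.find_spec hex
  have hmin : ∀ D' < Nat.find hex, ∀ y' : Fin D' → MvPolynomial (Fin n) k, ¬ IsParam I y' :=
    fun D' hD' y' hy' => Nat.find_min hex hD' ⟨y', hy'⟩
  have hinj := fun f => hy.injective_of_minimal hI hne hmin (f := f)
  exact ⟨_, hy.ringKrullDim_eq hI hinj, ⟨y, hy, hinj⟩, hmin⟩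

lemma finrank_homogeneousSubmodule (R : Type*) [CommRing R] [Nontrivial R] (s m : ℕ) :
    Module.finrank R (homogeneousSubmodule (Fin s) R m) = Nat.multichoose s m := by
  classical
  have hsupp : homogeneousSubmodule (Fin s) R m = restrictSupport R {d | d.degree = m} :=
    homogeneousSubmodule_eq_finsupp_supported _ _ _
  rw [hsupp, Module.finrank_eq_nat_card_basis (basisRestrictSupport R _)]
  have hcard := (Finset.univ : Finset (Fin s)).card_finsuppAntidiag_nat_eq_multichoose m
  rw [Finset.card_univ, Fintype.card_fin] at hcard
  rw [← hcard, ← Set.ncard_coe_finset, ← Nat.card_coe_set_eq]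
  congr 2
  ext d
  simp [Finset.mem_finsuppAntidiag, Finsupp.degree_eq_sum]

lemma multichoose_le_hilbertFunction {I : Ideal (MvPolynomial (Fin n) k)} {D : ℕ}
    {y : Fin D → MvPolynomial (Fin n) k} (hy : ∀ j, (y j).IsHomogeneous 1)
    (hinj : ∀ f : MvPolynomial (Fin D) k, aeval y f ∈ I → f = 0) (m : ℕ) :
    Nat.multichoose D m ≤ hilbertFunction I m := by
  set φ := ((Ideal.Quotient.mkₐ k I).comp (aeval y)).toLinearMap
  have hφ : Function.Injective φ :=
    (injective_iff_map_eq_zero φ).2 fun f hf => hinj f (Ideal.Quotient.eq_zero_iff_mem.1 hf)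
  rw [← finrank_homogeneousSubmodule k,
    LinearEquiv.finrank_eq (Submodule.equivMapOfInjective φ hφ _)]
  refine Submodule.finrank_mono ?_
  rintro _ ⟨f, hf, rfl⟩
  exact ⟨aeval y f, by simpa using IsHomogeneous.aeval hf y hy, rfl⟩

theorem le_of_hilbertSeries_mul {I : Ideal (MvPolynomial (Fin n) k)} {D D' : ℕ}
    {y : Fin D → MvPolynomial (Fin n) k} (hy : ∀ j, (y j).IsHomogeneous 1)
    (hinj : ∀ f : MvPolynomial (Fin D) k, aeval y f ∈ I → f = 0) {q : Polynomial ℤ}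
    (hq : (q : PowerSeries ℤ) = hilbertSeries I * (1 - PowerSeries.X) ^ D') : D ≤ D' := by
  by_contra! hlt
  have hD : D - D' ≠ 0 := by omega
  have hnonneg : 0 ≤ (q * (1 - Polynomial.X) ^ (D - D') - 1).eval 1 := by
    refine eval_one_nonneg_of_coeff_nonneg (D := D)
      (H := hilbertSeries I - PowerSeries.mk fun m => (Nat.multichoose D m : ℤ)) ?_ fun m => ?_
    · rw [sub_mul, mk_multichoose_mul_one_sub_X_pow]
      push_cast
      rw [hq, mul_assoc, ← pow_add, Nat.add_sub_cancel' hlt.le]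
    · simp only [hilbertSeries, map_sub, PowerSeries.coeff_mk, sub_nonneg]
      exact_mod_cast multichoose_le_hilbertFunction hy hinj m
  simp [hD] at hnonneg

end Noether

section GenericComplement

variable {σ R : Type*} [CommRing R]

theorem exists_pow_prod_leadingCoeff_mul_eq (m : MonomialOrder σ) (B : Finset (MvPolynomial σ R))
    (g : MvPolynomial σ R) :
    ∃ N : ℕ, ∃ j ∈ Ideal.span (B : Set (MvPolynomial σ R)),
      ∃ w ∈ restrictSupport R {d | ∀ b ∈ B, ¬ m.degree b ≤ d},
        C (∏ b ∈ B, m.leadingCoeff b) ^ N * g = j + w := by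
  classical
  induction hg : m.toSyn (m.degree g) using WellFoundedLT.induction generalizing g with
  | ind a ih =>
  subst hg
  have ih₀ (h : MvPolynomial σ R)
      (hh : m.toSyn (m.degree h) < m.toSyn (m.degree g) ∨ h = 0) :=
    hh.elim (fun hlt => ih _ hlt h rfl) fun h0 => ⟨0, 0, zero_mem _, 0, zero_mem _, by simp [h0]⟩
  by_cases! hB : ∀ b ∈ B, ¬ m.degree b ≤ m.degree g
  · have hlt : m.toSyn (m.degree (g - m.leadingTerm g)) < m.toSyn (m.degree g) ∨
        g - m.leadingTerm g = 0 := by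
      by_cases h0 : m.degree g = 0
      · exact .inr (sub_eq_zero.2 (by simpa [MonomialOrder.leadingTerm, h0] using
          MonomialOrder.degree_eq_zero_iff.1 h0))
      · exact .inl (MonomialOrder.degree_sub_leadingTerm_lt_degree h0)
    obtain ⟨N, j, hj, w, hw, hjw⟩ := ih₀ _ hlt
    refine ⟨N, j, hj, w + (∏ b ∈ B, m.leadingCoeff b) ^ N • m.leadingTerm g, add_mem hw
      (Submodule.smul_mem _ _ ((monomial_mem_restrictSupport R).2 (.inl hB))), ?_⟩
    rw [← add_assoc, ← hjw, smul_eq_C_mul, C_pow]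
    ring
  · obtain ⟨b, hbB, hb⟩ := hB
    obtain ⟨N, j, hj, w, hw, hjw⟩ := ih₀ (m.sPolynomial g b) (by
      simpa only [sup_of_le_left hb] using m.degree_sPolynomial g b)
    have hprod := Finset.mul_prod_erase B m.leadingCoeff hbB
    set F' := ∏ b ∈ B.erase b, m.leadingCoeff b
    rw [← hprod] at hjw ⊢
    rw [MonomialOrder.sPolynomial_def, sup_of_le_left (α := σ →₀ ℕ) hb, tsub_self,
      monomial_zero'] at hjw
    refine ⟨N + 1, C F' * j + C (m.leadingCoeff b * F') ^ N * C F' *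
      monomial (m.degree g - m.degree b) (m.leadingCoeff g) * b, ?_, F' • w,
      Submodule.smul_mem _ _ hw, ?_⟩
    · exact add_mem (Ideal.mul_mem_left _ _ hj) (Ideal.mul_mem_left _ _ (Ideal.subset_span hbB))
    · rw [C_mul] at hjw ⊢
      rw [smul_eq_C_mul, pow_succ]
      linear_combination C F' * hjw

theorem exists_finset_forall_degree_le [Finite σ] (m : MonomialOrder σ)
    (J : Ideal (MvPolynomial σ R)) :
    ∃ B : Finset (MvPolynomial σ R), (∀ b ∈ B, b ∈ J ∧ b ≠ 0) ∧
      ∀ f ∈ J, f ≠ 0 → ∃ b ∈ B, m.degree b ≤ m.degree f := by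
  classical
  set E : Set (σ →₀ ℕ) := {d | ∃ f, (f ∈ J ∧ f ≠ 0) ∧ m.degree f = d}
  have hfin : {d | Minimal (· ∈ E) d}.Finite :=
    WellQuasiOrderedLE.finite_of_isAntichain (setOfPred_minimal_antichain _)
  choose! r hrJ hrdeg using fun d (hd : Minimal (· ∈ E) d) => hd.prop
  refine ⟨hfin.toFinset.image r, ?_, fun f hfJ hf0 => ?_⟩
  · exact Finset.forall_mem_image.2 fun d hd => hrJ d (hfin.mem_toFinset.1 hd)
  · obtain ⟨d, hdf, hd⟩ := exists_minimal_le_of_wellFoundedLT (· ∈ E) (m.degree f)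
      ⟨f, ⟨hfJ, hf0⟩, rfl⟩
    exact ⟨r d, Finset.mem_image_of_mem r (hfin.mem_toFinset.2 hd), (hrdeg d hd).trans_le hdf⟩

/-- The `R`-submodule `W` becomes a complement of the ideal `J` of `R[x]` after inverting `F`. -/
structure IsComplementAway (F : R) (J : Ideal (MvPolynomial σ R))
    (W : Submodule R (MvPolynomial σ R)) : Prop where
  eq_zero : ∀ f ∈ J, f ∈ W → f = 0
  exists_add_eq : ∀ g, ∃ N : ℕ, ∃ j ∈ J, ∃ w ∈ W, C F ^ N * g = j + w

theorem exists_isComplementAway [IsDomain R] [LinearOrder σ] [Finite σ]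
    (J : Ideal (MvPolynomial σ R)) :
    ∃ F : R, F ≠ 0 ∧ ∃ W, IsComplementAway F J W := by
  let m : MonomialOrder σ := .lex
  obtain ⟨B, hBJ, hB⟩ := exists_finset_forall_degree_le m J
  refine ⟨∏ b ∈ B, m.leadingCoeff b, Finset.prod_ne_zero_iff.2 fun b hb =>
      MonomialOrder.leadingCoeff_ne_zero_iff.2 (hBJ b hb).2,
    restrictSupport R {d | ∀ b ∈ B, ¬ m.degree b ≤ d}, fun f hfJ hfW => ?_, fun g => ?_⟩
  · by_contra hf0
    obtain ⟨b, hbB, hb⟩ := hB f hfJ hf0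
    exact (mem_restrictSupport_iff R).1 hfW (m.degree_mem_support hf0) b hbB hb
  · obtain ⟨N, j, hj, hw⟩ := exists_pow_prod_leadingCoeff_mul_eq m B g
    exact ⟨N, j, Ideal.span_le.2 (fun b hb => (hBJ b hb).1) hj, hw⟩

namespace IsComplementAway

variable {F : R} {R' : Type*} [CommRing R'] {ev : R →+* R'}

lemma exists_pow_mul_mem_smul {J : Ideal (MvPolynomial σ R)} {W : Submodule R (MvPolynomial σ R)}
    (h : IsComplementAway F J W) {y : MvPolynomial σ R} (hy : y ∈ J) (hev : map ev y = 0) :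
    ∃ N : ℕ, C F ^ N * y ∈ RingHom.ker ev • (J.restrictScalars R : Submodule R _) := by
  classical
  have hmem : y ∈ RingHom.ker ev • (⊤ : Submodule R (MvPolynomial σ R)) := by
    rw [y.as_sum]
    refine sum_mem fun d _ => ?_
    rw [← mul_one (coeff d y), ← smul_eq_mul, ← smul_monomial]
    refine Submodule.smul_mem_smul ?_ trivial
    rw [RingHom.mem_ker, ← coeff_map, hev, coeff_zero]
  obtain ⟨N, j, hj, w, hw, hjw⟩ : ∃ N : ℕ, ∃ j ∈ RingHom.ker ev •
      (J.restrictScalars R : Submodule R _), ∃ w ∈ W, C F ^ N * y = j + w := by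
    refine Submodule.smul_induction_on hmem (fun c hc g _ => ?_) ?_
    · obtain ⟨N, j, hj, w, hw, hjw⟩ := h.exists_add_eq g
      refine ⟨N, c • j, Submodule.smul_mem_smul hc hj, c • w, W.smul_mem c hw, ?_⟩
      rw [← smul_add, ← hjw, mul_smul_comm]
    · rintro x z ⟨N, j, hj, w, hw, hjw⟩ ⟨N', j', hj', w', hw', hjw'⟩
      refine ⟨N + N', F ^ N' • j + F ^ N • j', add_mem (Submodule.smul_mem _ _ hj)
        (Submodule.smul_mem _ _ hj'), F ^ N' • w + F ^ N • w', add_mem (W.smul_mem _ hw)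
        (W.smul_mem _ hw'), ?_⟩
      simp only [smul_eq_C_mul, C_pow]
      linear_combination C F ^ N' * hjw + C F ^ N * hjw'
  have hwJ : w ∈ J := by
    rw [← sub_eq_of_eq_add' hjw]
    exact sub_mem (J.mul_mem_left _ hy) (Submodule.smul_le_right (N := J.restrictScalars R) hj)
  rw [h.eq_zero w hwJ hw, add_zero] at hjw
  exact ⟨N, hjw ▸ hj⟩

lemma exists_sub_mul_mem {J : Ideal (MvPolynomial σ R)} {L z : MvPolynomial σ R}
    (hz : z ∈ RingHom.ker ev • ((J ⊔ Ideal.span {L}).restrictScalars R : Submodule R _)) :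
    ∃ g, map ev g = 0 ∧ z - g * L ∈ J := by
  refine Submodule.smul_induction_on hz (fun c hc w hw => ?_) ?_
  · obtain ⟨u, hu, _, hv, rfl⟩ := Submodule.mem_sup.1 hw
    obtain ⟨g, rfl⟩ := Ideal.mem_span_singleton'.1 hv
    refine ⟨C c * g, by rw [map_mul, map_C, hc, map_zero, zero_mul], ?_⟩
    rw [smul_eq_C_mul, mul_add, mul_assoc, add_sub_cancel_right]
    exact J.mul_mem_left _ hu
  · rintro z w ⟨g, hg, hgz⟩ ⟨g', hg', hgw⟩
    refine ⟨g + g', by rw [map_add, hg, hg', add_zero], ?_⟩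
    rw [add_mul, add_sub_add_comm]
    exact add_mem hgz hgw

theorem exists_mem_colon_map_eq {J : Ideal (MvPolynomial σ R)} {L : MvPolynomial σ R}
    {W : Submodule R (MvPolynomial σ R)} (h : IsComplementAway F (J ⊔ Ideal.span {L}) W)
    (hev : Function.Surjective ev) {f : MvPolynomial σ R'}
    (hf : f ∈ (J.map (map ev)).colon {map ev L}) :
    ∃ N : ℕ, ∃ z ∈ J.colon {L}, map ev z = C (ev F) ^ N * f := by
  obtain ⟨f, rfl⟩ := map_surjective ev hev f
  rw [Submodule.mem_colon_singleton, smul_eq_mul, ← map_mul,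
    Ideal.mem_map_iff_of_surjective _ (map_surjective ev hev)] at hf
  obtain ⟨y, hyJ, hy⟩ := hf
  obtain ⟨N, hN⟩ := h.exists_pow_mul_mem_smul (ev := ev) (y := f * L - y)
    (sub_mem (Ideal.mul_mem_left _ _ (Ideal.mem_sup_right (Ideal.mem_span_singleton_self L)))
      (Ideal.mem_sup_left hyJ)) (by rw [map_sub, hy, sub_self])
  obtain ⟨g, hg, hgJ⟩ := exists_sub_mul_mem hN
  refine ⟨N, C F ^ N * f - g, ?_, by simp only [map_sub, map_mul, map_pow, map_C, hg, sub_zero]⟩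
  rw [Submodule.mem_colon_singleton, smul_eq_mul]
  convert add_mem hgJ (J.mul_mem_left (C F ^ N) hyJ) using 1
  ring

end IsComplementAway

end GenericComplement

section PartialIdeal

variable {R : Type*} [CommRing R] {s : ℕ}

/-- The ideal `P + (l₁, …, lᵢ)`. -/
def partialIdeal (P : Ideal R) (l : Fin s → R) (i : ℕ) : Ideal R :=
  P ⊔ Ideal.span (l '' {p | p.val < i})

lemma mem_partialIdeal (P : Ideal R) (l : Fin s → R) {i : ℕ} {p : Fin s} (hp : p.val < i) :
    l p ∈ partialIdeal P l i :=
  Ideal.mem_sup_right (Ideal.subset_span ⟨p, hp, rfl⟩)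

lemma partialIdeal_le {P J : Ideal R} {l : Fin s → R} {i : ℕ} :
    partialIdeal P l i ≤ J ↔ P ≤ J ∧ ∀ p : Fin s, p.val < i → l p ∈ J := by
  rw [partialIdeal, sup_le_iff, Ideal.span_le, Set.image_subset_iff]
  rfl

lemma partialIdeal_zero (P : Ideal R) (l : Fin s → R) : partialIdeal P l 0 = P := by
  simp [partialIdeal]

lemma partialIdeal_succ (P : Ideal R) (l : Fin s → R) (i : Fin s) :
    partialIdeal P l (i.val + 1) = partialIdeal P l i.val ⊔ Ideal.span {l i} := by
  have hset : {p : Fin s | p.val < i.val + 1} = {p | p.val < i.val} ∪ {i} := by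
    ext p
    simp only [Set.mem_union, Set.mem_ofPred_eq, Set.mem_singleton_iff, Fin.ext_iff]
    exact Nat.lt_succ_iff_lt_or_eq
  rw [partialIdeal, partialIdeal, hset, Set.image_union, Set.image_singleton, Ideal.span_union,
    sup_assoc]

lemma map_partialIdeal {A : Type*} [CommRing A] (φ : R →+* A) (P : Ideal R) (l : Fin s → R)
    (i : ℕ) : (partialIdeal P l i).map φ = partialIdeal (P.map φ) (φ ∘ l) i := by
  rw [partialIdeal, partialIdeal, Ideal.map_sup, Ideal.map_span, Set.image_comp]

end PartialIdeal

section Multiplier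

variable {A : Type*} [CommRing A]

/-- The elements of `A` that become congruent modulo `J` to elements of `E` after multiplication
by a power of `x ∈ E`. -/
def multiplierSubring (E : Subring A) (J : Ideal A) (x : E) : Subring A where
  carrier := {f | ∃ N : ℕ, ∃ g ∈ E, x ^ N * f - g ∈ J}
  zero_mem' := ⟨0, 0, E.zero_mem, by simp⟩
  one_mem' := ⟨0, 1, E.one_mem, by simp⟩
  neg_mem' := by
    rintro f ⟨N, g, hg, h⟩
    refine ⟨N, -g, E.neg_mem hg, ?_⟩
    convert J.neg_mem h using 1
    ring
  add_mem' := by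
    rintro f f' ⟨N, g, hg, h⟩ ⟨N', g', hg', h'⟩
    refine ⟨N + N', x ^ N' * g + x ^ N * g', E.add_mem (E.mul_mem (E.pow_mem x.2 _) hg)
      (E.mul_mem (E.pow_mem x.2 _) hg'), ?_⟩
    convert add_mem (J.mul_mem_left (x.val ^ N') h) (J.mul_mem_left (x.val ^ N) h') using 1
    ring
  mul_mem' := by
    rintro f f' ⟨N, g, hg, h⟩ ⟨N', g', hg', h'⟩
    refine ⟨N + N', g * g', E.mul_mem hg hg', ?_⟩
    convert add_mem (J.mul_mem_left (x.val ^ N' * f') h) (J.mul_mem_left g h') using 1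
    ring

lemma le_multiplierSubring (E : Subring A) (J : Ideal A) (x : E) :
    E ≤ multiplierSubring E J x :=
  fun f hf => ⟨0, f, hf, by simp⟩

end Multiplier

section Generic

variable {k : Type*} [Field k] {n s : ℕ}

/-- The `i`-th generic linear form, whose coefficients are indeterminates. -/
def genericForm (k : Type*) [Field k] (n : ℕ) {s : ℕ} (i : Fin s) :
    MvPolynomial (Fin n) (MvPolynomial (Fin s × Fin n) k) :=
  ∑ q, C (X (i, q)) * X q

/-- The extension of an ideal of `k[x]` to the polynomial ring over the ring of coefficients of the
generic forms. -/
def genericExtension (s : ℕ) (P : Ideal (MvPolynomial (Fin n) k)) :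
    Ideal (MvPolynomial (Fin n) (MvPolynomial (Fin s × Fin n) k)) :=
  P.map (map C)

lemma map_eval_map_C {σ τ : Type*} (a : τ → k) (g : MvPolynomial σ k) :
    map (eval a) (map C g) = g := by
  rw [map_map, show (eval a).comp C = RingHom.id k from RingHom.ext eval_C, map_id]

lemma map_genericExtension (a : Fin s × Fin n → k) (P : Ideal (MvPolynomial (Fin n) k)) :
    (genericExtension s P).map (map (eval a)) = P := by
  rw [genericExtension, Ideal.map_map,
    show (map (eval a)).comp (map C) = RingHom.id _ from RingHom.ext (map_eval_map_C a),
    Ideal.map_id]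

lemma map_eval_genericForm (a : Fin s × Fin n → k) (i : Fin s) :
    map (eval a) (genericForm k n i) = linearForm fun q => a (i, q) := by
  simp [genericForm, linearForm]

section Elimination

variable {K : Type*} [Field K] (γ : MvPolynomial (Fin n) k →+* K)

/-- The evaluation `x ↦ γ(x)` of the variables of `k[u][x]`, combined with a substitution `U` of the
coefficients `u` of the generic forms. -/
def substGeneric (U : Fin s × Fin n → MvPolynomial (Fin s × Fin n) K) :
    MvPolynomial (Fin n) (MvPolynomial (Fin s × Fin n) k) →+* MvPolynomial (Fin s × Fin n) K :=
  eval₂Hom (eval₂Hom (C.comp (γ.comp C)) U) (fun q => C (γ (X q)))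

@[simp]
lemma substGeneric_X (U : Fin s × Fin n → MvPolynomial (Fin s × Fin n) K) (q : Fin n) :
    substGeneric γ U (X q) = C (γ (X q)) := by simp [substGeneric]

@[simp]
lemma substGeneric_C_X (U : Fin s × Fin n → MvPolynomial (Fin s × Fin n) K) (p : Fin s × Fin n) :
    substGeneric γ U (C (X p)) = U p := by simp [substGeneric]

@[simp]
lemma substGeneric_C_C (U : Fin s × Fin n → MvPolynomial (Fin s × Fin n) K) (c : k) :
    substGeneric γ U (C (C c)) = C (γ (C c)) := by simp [substGeneric]

lemma substGeneric_map (U : Fin s × Fin n → MvPolynomial (Fin s × Fin n) K)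
    (f : MvPolynomial (Fin n) k) : substGeneric γ U (map C f) = C (γ f) := by
  have h : (substGeneric γ U).comp (map C) = C.comp γ :=
    ringHom_ext (by simp) (by simp)
  exact RingHom.congr_fun h f

lemma ker_substGeneric_X :
    RingHom.ker (substGeneric (s := s) γ X) = genericExtension s (RingHom.ker γ) := by
  let e := (commAlgEquiv k (Fin n) (Fin s × Fin n)).toRingEquiv
  have hsubst : substGeneric (s := s) γ X = (map γ).comp e.toRingHom := by
    refine ringHom_ext' (ringHom_ext' ?_ ?_) ?_
    · ext c; simp [e, substGeneric]
    · intro p; simp [e, substGeneric]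
    · intro q; simp [e, substGeneric]
  have hC : e.toRingHom.comp (map C) = C := ringHom_ext (by simp [e]) (by simp [e])
  rw [hsubst, ← RingHom.comap_ker, ker_map, genericExtension, ← hC, ← Ideal.map_map]
  exact Ideal.comap_map_of_bijective e e.bijective

/-- For `p < i`, the coefficient of `xⱼ` in the `p`-th generic form is replaced by the value for
which the form vanishes at the point `γ`. -/
def eliminate (i : ℕ) (j : Fin n) (p : Fin s × Fin n) : MvPolynomial (Fin s × Fin n) K :=
  if p.2 = j ∧ p.1.val < i then
    - ∑ q ∈ Finset.univ.erase j, X (p.1, q) * C (γ (X q) * (γ (X j))⁻¹)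
  else X p

lemma eliminate_of_ne {i : ℕ} {j q : Fin n} (hq : q ≠ j) (p : Fin s) :
    eliminate γ i j (p, q) = X (p, q) :=
  if_neg fun h => hq h.1

lemma eliminate_of_le {i : ℕ} (j : Fin n) {p : Fin s × Fin n} (hp : i ≤ p.1.val) :
    eliminate γ i j p = X p :=
  if_neg fun h => hp.not_gt h.2

lemma partialIdeal_genericForm_le_ker {i : ℕ} {j : Fin n} (hj : γ (X j) ≠ 0) :
    partialIdeal (genericExtension s (RingHom.ker γ)) (genericForm k n) i ≤
      RingHom.ker (substGeneric γ (eliminate γ i j)) := by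
  refine partialIdeal_le.2 ⟨Ideal.map_le_iff_le_comap.2 fun g hg => ?_, fun p hp => ?_⟩
  · rw [Ideal.mem_comap, RingHom.mem_ker, substGeneric_map, hg, map_zero]
  · rw [RingHom.mem_ker, genericForm, map_sum, ← Finset.add_sum_erase _ _ (Finset.mem_univ j)]
    simp only [map_mul, substGeneric_X, substGeneric_C_X]
    rw [eliminate, if_pos ⟨rfl, hp⟩, neg_mul, Finset.sum_mul, neg_add_eq_zero]
    refine Finset.sum_congr rfl fun q hq => ?_
    rw [eliminate_of_ne γ (Finset.ne_of_mem_erase hq), mul_assoc, ← C_mul, mul_assoc,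
      inv_mul_cancel₀ hj, mul_one]

lemma exists_pow_mul_sub_mem_partialIdeal (i : ℕ) (j : Fin n)
    (f : MvPolynomial (Fin n) (MvPolynomial (Fin s × Fin n) k)) :
    ∃ N : ℕ, ∃ g, substGeneric γ (eliminate γ i j) g = substGeneric γ X g ∧
      X j ^ N * f - g ∈
        partialIdeal (genericExtension s (RingHom.ker γ)) (genericForm k n) i := by
  set J := partialIdeal (genericExtension s (RingHom.ker γ)) (genericForm k n) i
  set E : Subring (MvPolynomial (Fin n) (MvPolynomial (Fin s × Fin n) k)) :=
    (substGeneric γ (eliminate γ i j)).eqLocus (substGeneric γ X)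
  have hX (q : Fin n) : X q ∈ E := by simp [E]
  set M := multiplierSubring E J ⟨X j, hX j⟩
  have hEM : E ≤ M := le_multiplierSubring E J _
  have hCX (p : Fin s × Fin n) : C (X p) ∈ M := by
    by_cases hp : p.2 = j ∧ p.1.val < i
    · refine ⟨1, - ∑ q ∈ Finset.univ.erase j, C (X (p.1, q)) * X q,
        E.neg_mem (sum_mem fun q hq => E.mul_mem ?_ (hX q)), ?_⟩
      · simp [E, eliminate_of_ne γ (Finset.ne_of_mem_erase hq)]
      · have hmem : genericForm k n p.1 ∈ J := mem_partialIdeal _ _ hp.2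
        rw [genericForm, ← Finset.add_sum_erase _ _ (Finset.mem_univ j)] at hmem
        convert hmem using 1
        rw [← hp.1]
        ring
    · exact hEM (by simp [E, eliminate, if_neg hp])
  change f ∈ M
  induction f using MvPolynomial.induction_on with
  | add f f' hf hf' => exact M.add_mem hf hf'
  | mul_X f q hf => exact M.mul_mem hf (hEM (hX q))
  | C c =>
    induction c using MvPolynomial.induction_on with
    | C c => exact hEM (by simp [E])
    | add f f' hf hf' => exact C_add (R := MvPolynomial (Fin s × Fin n) k) ▸ M.add_mem hf hf'
    | mul_X f p hf => exact C_mul (R := MvPolynomial (Fin s × Fin n) k) ▸ M.mul_mem hf (hCX p)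

lemma substGeneric_eliminate_genericForm_ne_zero {i : Fin s} {j : Fin n} (hj : γ (X j) ≠ 0) :
    substGeneric γ (eliminate γ i.val j) (genericForm k n i) ≠ 0 := by
  classical
  have hform : substGeneric γ (eliminate γ i.val j) (genericForm k n i) =
      ∑ q, C (γ (X q)) * X (i, q) := by
    rw [genericForm, map_sum]
    refine Finset.sum_congr rfl fun q _ => ?_
    rw [map_mul, substGeneric_X, substGeneric_C_X, eliminate_of_le γ j (p := (i, q)) le_rfl,
      mul_comm]
  have hcoeff : coeff (Finsupp.single (i, j) 1)
      (substGeneric γ (eliminate γ i.val j) (genericForm k n i)) = γ (X j) := by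
    simp [hform, coeff_sum, coeff_C_mul, coeff_X, Finsupp.single_left_inj]
  intro h0
  rw [h0, coeff_zero] at hcoeff
  exact hj hcoeff.symm

/-- Where `γ(xⱼ) ≠ 0`, the first `i` generic forms can be solved for their coefficients of `xⱼ`; the
quotient by them is then a polynomial ring over a domain, and the next generic form is nonzero. -/
lemma mem_radical_colon_genericForm {i : Fin s} {j : Fin n} (hj : γ (X j) ≠ 0)
    {f : MvPolynomial (Fin n) (MvPolynomial (Fin s × Fin n) k)}
    (hf : f ∈ (partialIdeal (genericExtension s (RingHom.ker γ)) (genericForm k n) i.val).colon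
      {genericForm k n i}) :
    X j ∈ ((partialIdeal (genericExtension s (RingHom.ker γ)) (genericForm k n) i.val).colon
      {f}).radical := by
  obtain ⟨N, g, hθ, hg⟩ := exists_pow_mul_sub_mem_partialIdeal γ i.val j f
  have hle := partialIdeal_genericForm_le_ker (s := s) γ (i := i.val) hj
  have hf0 : substGeneric γ (eliminate γ i.val j) f = 0 := by
    have hmul := hle (Submodule.mem_colon_singleton.1 hf)
    rw [smul_eq_mul, RingHom.mem_ker, map_mul] at hmul
    exact (mul_eq_zero.1 hmul).resolve_right (substGeneric_eliminate_genericForm_ne_zero γ hj)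
  have hg0 : substGeneric γ X g = 0 := by
    have hsub := hle hg
    rwa [RingHom.mem_ker, map_sub, map_mul, hf0, mul_zero, zero_sub, neg_eq_zero, hθ] at hsub
  have hgext : g ∈ genericExtension s (RingHom.ker γ) := by rwa [← ker_substGeneric_X]
  refine ⟨N, Submodule.mem_colon_singleton.2 ?_⟩
  rw [smul_eq_mul, ← sub_add_cancel (X j ^ N * f) g]
  exact add_mem hg (Ideal.mem_sup_left hgext)

end Elimination

theorem X_mem_radical_colon_genericForm {P : Ideal (MvPolynomial (Fin n) k)} (hP : P.IsPrime)
    {i : Fin s} {f : MvPolynomial (Fin n) (MvPolynomial (Fin s × Fin n) k)}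
    (hf : f ∈ (partialIdeal (genericExtension s P) (genericForm k n) i.val).colon
      {genericForm k n i}) (j : Fin n) :
    X j ∈ ((partialIdeal (genericExtension s P) (genericForm k n) i.val).colon {f}).radical := by
  by_cases hXj : X j ∈ P
  · refine Ideal.le_radical (Ideal.le_colon (Ideal.mem_sup_left ?_))
    rw [← map_X C]
    exact Ideal.mem_map_of_mem _ hXj
  · let γ : MvPolynomial (Fin n) k →+* FractionRing (MvPolynomial (Fin n) k ⧸ P) :=
      (algebraMap (MvPolynomial (Fin n) k ⧸ P) _).comp (Ideal.Quotient.mk P)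
    have hγ : RingHom.ker γ = P := by
      rw [← RingHom.comap_ker,
        (RingHom.injective_iff_ker_eq_bot _).1 (IsFractionRing.injective _ _)]
      exact Ideal.mk_ker
    have hj : γ (X j) ≠ 0 := by rwa [Ne, ← RingHom.mem_ker, hγ]
    rw [← hγ] at hf ⊢
    exact mem_radical_colon_genericForm γ hj hf

/-- `l₁, …, lₛ` is filter-regular on `S / P`: each `lᵢ₊₁` is a nonzerodivisor on
`S / (P + (l₁, …, lᵢ))` up to torsion with respect to the variables. -/
def IsFilterRegular (P : Ideal (MvPolynomial (Fin n) k)) (l : Fin s → MvPolynomial (Fin n) k) :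
    Prop :=
  ∀ i : Fin s, ∀ f ∈ (partialIdeal P l i.val).colon {l i},
    IsIrrelevant ((partialIdeal P l i.val).colon {f})

/-- A complement of `P + (L₁, …, Lᵢ₊₁)` for the generic forms `L` controls all colon ideals
`(P + (l₁, …, lᵢ)) : lᵢ₊₁` at once: they are specializations of the generic one. -/
theorem exists_forall_isFilterRegular {P : Ideal (MvPolynomial (Fin n) k)} (hP : P.IsPrime)
    (s : ℕ) : ∃ F : MvPolynomial (Fin s × Fin n) k, F ≠ 0 ∧ ∀ a : Fin s → Fin n → k,
      eval (fun p => a p.1 p.2) F ≠ 0 → IsFilterRegular P (fun i => linearForm (a i)) := by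
  set J := partialIdeal (genericExtension s P) (genericForm k n)
  choose F hF0 W hW using fun i : Fin s => exists_isComplementAway (J (i.val + 1))
  refine ⟨∏ i, F i, Finset.prod_ne_zero_iff.2 fun i _ => hF0 i, fun a ha i f hf j => ?_⟩
  set ev : MvPolynomial (Fin s × Fin n) k →+* k := eval fun p => a p.1 p.2
  have hFi : ev (F i) ≠ 0 := by
    rw [map_prod] at ha
    exact Finset.prod_ne_zero_iff.1 ha i (Finset.mem_univ i)
  have hJ : (J i.val).map (map ev) = partialIdeal P (fun i => linearForm (a i)) i.val := by
    rw [map_partialIdeal, map_genericExtension]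
    exact congrArg (partialIdeal P · i.val) (funext (map_eval_genericForm _))
  have hWi : IsComplementAway (F i) (J i.val ⊔ Ideal.span {genericForm k n i}) (W i) :=
    partialIdeal_succ (genericExtension s P) (genericForm k n) i ▸ hW i
  obtain ⟨M, z, hz, hzf⟩ := hWi.exists_mem_colon_map_eq (ev := ev) (f := f)
    (fun c => ⟨C c, eval_C c⟩) (by rwa [hJ, map_eval_genericForm])
  obtain ⟨N, hN⟩ := X_mem_radical_colon_genericForm hP hz j
  refine ⟨N, Submodule.mem_colon_singleton.2 ?_⟩
  have hmem := Ideal.mem_map_of_mem (map ev) (Submodule.mem_colon_singleton.1 hN)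
  have hunit : IsUnit (C (ev (F i)) ^ M : MvPolynomial (Fin n) k) :=
    (hFi.isUnit.map C).pow M
  rwa [hJ, smul_eq_mul, map_mul, map_pow, map_X, hzf, mul_left_comm,
    Ideal.unit_mul_mem_iff_mem _ hunit] at hmem

end Generic

section GradedMaps

variable {k : Type*} [Field k] {n r : ℕ}

lemma isHomogeneous_linearForm (a : Fin n → k) : (linearForm a).IsHomogeneous 1 :=
  IsHomogeneous.sum _ _ _ fun i _ => isHomogeneous_C_mul_X (a i) i

lemma eq_linearForm {l : MvPolynomial (Fin n) k} (hl : l.IsHomogeneous 1) :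
    l = linearForm (linCoeff l) := by
  classical
  ext d
  by_cases hd : d.degree = 1
  · obtain ⟨i, rfl⟩ : ∃ i, d = Finsupp.single i 1 := by
      obtain ⟨i, hi⟩ := Multiset.card_eq_one.1 ((Finsupp.card_toMultiset d).trans hd)
      exact ⟨i, by rw [← Finsupp.toMultiset_toFinsupp d, hi, Multiset.toFinsupp_singleton]⟩
    exact (linCoeff_linearForm (linCoeff l) i).symm
  · rw [hl.coeff_eq_zero hd, (isHomogeneous_linearForm _).coeff_eq_zero hd]

variable {ψ : MvPolynomial (Fin n) k →ₐ[k] MvPolynomial (Fin r) k}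

lemma isHomogeneous_algHom (hψ : ∀ j, (ψ (X j)).IsHomogeneous 1) {f : MvPolynomial (Fin n) k}
    {m : ℕ} (hf : f.IsHomogeneous m) : (ψ f).IsHomogeneous m := by
  rw [aeval_unique ψ, ← one_mul m]
  exact hf.aeval _ hψ

lemma map_homogeneousSubmodule (hψ : ∀ j, (ψ (X j)).IsHomogeneous 1)
    (hs : Function.Surjective ψ) (m : ℕ) :
    (homogeneousSubmodule (Fin n) k m).map ψ.toLinearMap = homogeneousSubmodule (Fin r) k m := by
  ext f
  constructor
  · rintro ⟨g, hg, rfl⟩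
    exact isHomogeneous_algHom hψ hg
  · intro hf
    obtain ⟨g, rfl⟩ := hs f
    refine ⟨homogeneousComponent m g, homogeneousComponent_isHomogeneous _ _, ?_⟩
    have hcomm := homogeneousComponent_aeval (y := ψ ∘ X) hψ g m
    rw [← aeval_unique ψ] at hcomm
    rw [AlgHom.toLinearMap_apply, ← hcomm, homogeneousComponent_eq_self hf]

lemma hilbertFunction_comap (hψ : ∀ j, (ψ (X j)).IsHomogeneous 1) (hs : Function.Surjective ψ)
    (I : Ideal (MvPolynomial (Fin r) k)) : hilbertFunction (I.comap ψ) = hilbertFunction I := by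
  funext m
  let θ := Ideal.quotientMapₐ I ψ le_rfl
  have hθ : Function.Injective θ := Ideal.quotientMap_injective
  have hcomp : (Ideal.Quotient.mkₐ k I).toLinearMap ∘ₗ ψ.toLinearMap =
      θ.toLinearMap ∘ₗ (Ideal.Quotient.mkₐ k (I.comap ψ)).toLinearMap := rfl
  rw [hilbertFunction, hilbertFunction, ← map_homogeneousSubmodule hψ hs, ← Submodule.map_comp,
    hcomp, Submodule.map_comp]
  exact (Submodule.equivMapOfInjective θ.toLinearMap hθ _).finrank_eq

lemma quotientDim_comap (hs : Function.Surjective ψ) (I : Ideal (MvPolynomial (Fin r) k)) :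
    quotientDim (I.comap ψ) = quotientDim I := by
  have e : (MvPolynomial (Fin n) k ⧸ I.comap ψ) ≃ₐ[k] (MvPolynomial (Fin r) k ⧸ I) :=
    .ofBijective (Ideal.quotientMapₐ I ψ le_rfl)
      ⟨Ideal.quotientMap_injective, Ideal.quotientMap_surjective (H := le_rfl) hs⟩
  rw [quotientDim, quotientDim, ringKrullDim_eq_of_ringEquiv e.toRingEquiv]

lemma hilbertCoeff_congr {I : Ideal (MvPolynomial (Fin n) k)} {J : Ideal (MvPolynomial (Fin r) k)}
    (hfun : hilbertFunction I = hilbertFunction J) (hdim : quotientDim I = quotientDim J) :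
    hilbertCoeff I = hilbertCoeff J := by
  funext i
  have hnum : hilbertNumerator I = hilbertNumerator J := by
    have hH : hilbertSeries I = hilbertSeries J := by rw [hilbertSeries, hilbertSeries, hfun]
    unfold hilbertNumerator
    rw! [hH, hdim]
    rfl
  rw [hilbertCoeff, hilbertCoeff, hnum]

lemma hilbertCoeff_map (hψ : ∀ j, (ψ (X j)).IsHomogeneous 1) (hs : Function.Surjective ψ)
    (P : Ideal (MvPolynomial (Fin n) k)) :
    hilbertCoeff (P.map ψ) = hilbertCoeff (P ⊔ RingHom.ker ψ) := by
  rw [← hilbertCoeff_congr (hilbertFunction_comap hψ hs _) (quotientDim_comap hs _),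
    Ideal.comap_map_of_surjective' ψ hs]

end GradedMaps

section IterProj

variable {k : Type*} [Field k]

lemma isHomogeneous_proj_X {m : ℕ} (l : MvPolynomial (Fin (m + 1)) k) (j : Fin (m + 1)) :
    (proj l (X j)).IsHomogeneous 1 := by
  rw [proj, aeval_X]
  refine Fin.lastCases ?_ (fun i => ?_) j
  · rw [Fin.snoc_last]
    exact IsHomogeneous.sum _ _ _ fun i _ => isHomogeneous_C_mul_X _ i
  · rw [Fin.snoc_castSucc]
    exact isHomogeneous_X k i

lemma proj_surjective {m : ℕ} (l : MvPolynomial (Fin (m + 1)) k) : Function.Surjective (proj l) :=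
  fun f => ⟨_, proj_rename l f⟩

lemma isHomogeneous_iterProj_X (s r : ℕ) (l : Fin s → MvPolynomial (Fin (r + s)) k)
    (j : Fin (r + s)) : (iterProj s r l (X j)).IsHomogeneous 1 := by
  induction s with
  | zero => exact isHomogeneous_X k j
  | succ s ih => exact isHomogeneous_algHom (ih _) (isHomogeneous_proj_X (m := r + s) (l 0) j)

lemma iterProj_surjective (s r : ℕ) (l : Fin s → MvPolynomial (Fin (r + s)) k) :
    Function.Surjective (iterProj s r l) := by
  induction s with
  | zero => exact Function.surjective_id
  | succ s ih => exact (ih _).comp (proj_surjective (m := r + s) (l 0))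

lemma ker_iterProj (s r : ℕ) (l : Fin s → MvPolynomial (Fin (r + s)) k)
    (hl : ∀ i, (l i).IsHomogeneous 1) (hdef : IterProjDefined s r l) :
    RingHom.ker (iterProj s r l) = Ideal.span (Set.range l) := by
  induction s with
  | zero =>
    rw [Set.range_eq_empty, Ideal.span_empty]
    exact (RingHom.injective_iff_ker_eq_bot _).1 Function.injective_id
  | succ s ih =>
    obtain ⟨h0, hdef⟩ := hdef
    set π := proj (m := r + s) (l 0) with hπ
    have hker : RingHom.ker π = Ideal.span {l 0} := by
      rw [hπ, eq_linearForm (n := r + s + 1) (hl 0)]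
      exact ker_proj (m := r + s) _ h0
    have hih := ih (fun i => π (l i.succ))
      (fun i => isHomogeneous_algHom (isHomogeneous_proj_X (m := r + s) (l 0)) (hl _)) hdef
    have hcomp : RingHom.ker (iterProj (s + 1) r l) =
        (RingHom.ker (iterProj s r fun i => π (l i.succ))).comap π := rfl
    have hspan : Ideal.span (Set.range fun i : Fin s => π (l i.succ)) =
        (Ideal.span (Set.range fun i : Fin s => l i.succ)).map π := by
      rw [Ideal.map_span, ← Set.range_comp]
      rfl
    rw [hcomp, hih, hspan, Ideal.comap_map_of_surjective' _ (proj_surjective (m := r + s) (l 0)),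
      hker, ← Ideal.span_union, Set.union_singleton, ← Fin.range_cons (l 0) fun i => l i.succ]
    exact congrArg (fun f => Ideal.span (Set.range f)) (Fin.cons_self_tail l)

lemma linCoeff_C_mul {n : ℕ} (c : k) (l : MvPolynomial (Fin n) k) (i : Fin n) :
    linCoeff (C c * l) i = c * linCoeff l i := coeff_C_mul _ _ _

lemma proj_C_mul {m : ℕ} {c : k} (hc : c ≠ 0) (l : MvPolynomial (Fin (m + 1)) k) :
    proj (C c * l) = proj l := by
  rw [proj, proj]
  congr 2
  refine Finset.sum_congr rfl fun i _ => ?_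
  rw [linCoeff_C_mul, linCoeff_C_mul, mul_inv]
  congr 2
  field_simp

lemma IterProjDefined.of_C_mul {c : k} (hc : c ≠ 0) {s r : ℕ}
    {l : Fin s → MvPolynomial (Fin (r + s)) k}
    (h : IterProjDefined s r fun i => C c * l i) : IterProjDefined s r l := by
  induction s with
  | zero => trivial
  | succ s ih =>
    obtain ⟨h0, h⟩ := h
    rw [linCoeff_C_mul] at h0
    refine ⟨right_ne_zero_of_mul h0, ih ?_⟩
    rw [proj_C_mul hc] at h
    simpa only [map_mul, algHom_C, algebraMap_eq] using h

lemma C_mul_proj_linearForm {m : ℕ} (a b : Fin (m + 1) → k) (ha : a (Fin.last m) ≠ 0) :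
    C (a (Fin.last m)) * proj (linearForm a) (linearForm b) =
      linearForm fun i => a (Fin.last m) * b i.castSucc - b (Fin.last m) * a i.castSucc := by
  have hb : linearForm b =
      ∑ i : Fin m, C (b i.castSucc) * X i.castSucc + C (b (Fin.last m)) * X (Fin.last m) :=
    Fin.sum_univ_castSucc _
  simp only [hb, proj, linCoeff_linearForm, map_add, map_sum, map_mul, aeval_X, algHom_C,
    Fin.snoc_castSucc, Fin.snoc_last, algebraMap_eq, Finset.mul_sum, ← Finset.sum_add_distrib,
    mul_add]
  refine Finset.sum_congr rfl fun i _ => ?_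
  have hinv : (C (a (Fin.last m)) * C (a (Fin.last m))⁻¹ : MvPolynomial (Fin m) k) = 1 := by
    rw [← C_mul, mul_inv_cancel₀ ha, C_1]
  simp only [map_neg, C_sub, C_mul]
  linear_combination (-(C (b (Fin.last m)) * C (a i.castSucc) * X i)) * hinv

/-- One step of the elimination: the coefficients of the forms `a₀,ₘ · π(lᵢ)`, where `π` projects
along `l₀`, as polynomials in the coefficients of the forms. -/
def eliminationMinor (k : Type*) [Field k] {s m : ℕ} (p : Fin s × Fin m) :
    MvPolynomial (Fin (s + 1) × Fin (m + 1)) k :=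
  X (0, Fin.last m) * X (p.1.succ, p.2.castSucc) - X (p.1.succ, Fin.last m) * X (0, p.2.castSucc)

lemma eval_bind₁_eliminationMinor {s m : ℕ} (F : MvPolynomial (Fin s × Fin m) k)
    (a : Fin (s + 1) → Fin (m + 1) → k) :
    eval (fun p => a p.1 p.2) (bind₁ (eliminationMinor k) F) =
      eval (fun p => a 0 (Fin.last m) * a p.1.succ p.2.castSucc -
        a p.1.succ (Fin.last m) * a 0 p.2.castSucc) F := by
  refine (eval₂Hom_bind₁ _ _ _ F).trans (congrArg (eval · F) (funext fun p => ?_))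
  simp [eliminationMinor]

theorem exists_forall_iterProjDefined (k : Type*) [Field k] (s r : ℕ) :
    ∃ F : MvPolynomial (Fin s × Fin (r + s)) k,
      (∃ b : Fin s → Fin (r + s) → k, eval (fun p => b p.1 p.2) F ≠ 0) ∧
        ∀ a : Fin s → Fin (r + s) → k, eval (fun p => a p.1 p.2) F ≠ 0 →
          IterProjDefined s r fun i => linearForm (a i) := by
  induction s with
  | zero => exact ⟨1, ⟨fun _ _ => 0, by simp⟩, fun _ _ => trivial⟩
  | succ s ih =>
    obtain ⟨F, ⟨b, hb⟩, hF⟩ := ih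
    let last : Fin (r + s + 1) := Fin.last (r + s)
    have heval (a : Fin (s + 1) → Fin (r + s + 1) → k) :
        eval (fun p => a p.1 p.2) (X (0, last) * bind₁ (eliminationMinor k) F) =
          a 0 last * eval (fun p => a 0 last * a p.1.succ p.2.castSucc -
            a p.1.succ last * a 0 p.2.castSucc) F := by
      rw [map_mul, eval_X]
      exact congrArg (a 0 last * ·) (eval_bind₁_eliminationMinor F a)
    refine ⟨X (0, last) * bind₁ (eliminationMinor k) F,
      ⟨Fin.cons (Pi.single last 1) fun i => Fin.snoc (b i) 0, ?_⟩, fun a ha => ?_⟩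
    · refine fun h0 => hb ?_
      simpa [last] using (heval _).symm.trans h0
    · replace ha := fun h0 => ha ((heval a).trans h0)
      have h0 : a 0 last ≠ 0 := left_ne_zero_of_mul ha
      refine ⟨by rwa [linCoeff_linearForm], .of_C_mul h0 ?_⟩
      convert hF (fun i j => a 0 last * a i.succ j.castSucc - a i.succ last * a 0 j.castSucc)
        (right_ne_zero_of_mul ha) using 2 with i
      exact C_mul_proj_linearForm (m := r + s) (a 0) (a i.succ) h0

end IterProj

section FilterRegular

variable {k : Type*} [Field k] {n s : ℕ} {P : Ideal (MvPolynomial (Fin n) k)}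
  {l : Fin s → MvPolynomial (Fin n) k}

lemma IsHomogeneousIdeal.partialIdeal (hP : IsHomogeneousIdeal P)
    (hl : ∀ i, (l i).IsHomogeneous 1) (i : ℕ) : IsHomogeneousIdeal (partialIdeal P l i) :=
  hP.sup (isHomogeneousIdeal_span (Set.forall_mem_image.2 fun p _ => hl p))

lemma partialIdeal_eq_sup_span_range : partialIdeal P l s = P ⊔ Ideal.span (Set.range l) := by
  have huniv : {p : Fin s | p.val < s} = Set.univ := Set.eq_univ_of_forall fun p => p.2
  rw [partialIdeal, huniv, Set.image_univ]

lemma partialIdeal_ne_top (hP : IsHomogeneousIdeal P) (hne : P ≠ ⊤)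
    (hl : ∀ i, (l i).IsHomogeneous 1) (i : ℕ) : partialIdeal P l i ≠ ⊤ := by
  rw [Ne, Ideal.eq_top_iff_one] at hne ⊢
  exact fun h => hne
    (hP.mem_of_mem_sup_span one_pos (Set.forall_mem_image.2 fun p _ => hl p)
      (isHomogeneous_one _ _) h)

/-- The polynomial `T` is the Hilbert series of `(I : l) / I`, so `T(1)` is the length of this
module. -/
lemma exists_hilbertSeries_sup_span_singleton {I : Ideal (MvPolynomial (Fin n) k)}
    (hI : IsHomogeneousIdeal I) {l : MvPolynomial (Fin n) k} (hl : l.IsHomogeneous 1)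
    (h : ∀ f ∈ I.colon {l}, IsIrrelevant (I.colon {f})) :
    ∃ T : Polynomial ℤ,
      hilbertSeries (I ⊔ Ideal.span {l}) = hilbertSeries I * (1 - PowerSeries.X) +
        PowerSeries.X * (T : PowerSeries ℤ) ∧
      (T.eval 1 ≠ 0 → ∃ f ∈ I.colon {l}, f ∉ I) := by
  obtain ⟨N, hN⟩ := exists_forall_mem_of_torsion h
  set t : ℕ → ℤ := fun m => hilbertFunction I m - hilbertFunction (I.colon {l}) m
  have ht : PowerSeries.mk t = hilbertSeries I - hilbertSeries (I.colon {l}) := by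
    ext m
    simp [t, hilbertSeries]
  refine ⟨(PowerSeries.mk t).trunc N, ?_, ?_⟩
  · rw [coe_trunc_mk_of_eventually_zero t N fun m hm => ?_, ht]
    · linear_combination (-1 : PowerSeries ℤ) * hilbertSeries_eq_X_mul_colon_add_sup hI hl
    · rw [sub_eq_zero, Nat.cast_inj]
      exact hilbertFunction_congr fun f hf => ⟨fun hfI => Ideal.le_colon hfI, hN m hm f hf⟩
  · contrapose!
    intro hall
    have hcolon : I.colon {l} = I := le_antisymm hall Ideal.le_colon
    rw [ht, hcolon, sub_self]
    simp

lemma exists_hilbertSeries_partialIdeal_succ (hP : IsHomogeneousIdeal P)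
    (hl : ∀ i, (l i).IsHomogeneous 1) (hreg : IsFilterRegular P l) (i : Fin s) {G : Polynomial ℤ}
    (hG : hilbertSeries (partialIdeal P l i.val) =
      hilbertSeries P * (1 - PowerSeries.X) ^ i.val + (G : PowerSeries ℤ)) :
    ∃ G' : Polynomial ℤ, hilbertSeries (partialIdeal P l (i.val + 1)) =
        hilbertSeries P * (1 - PowerSeries.X) ^ (i.val + 1) + (G' : PowerSeries ℤ) ∧
      (G'.eval 1 ≠ 0 → ∃ f ∈ (partialIdeal P l i.val).colon {l i}, f ∉ partialIdeal P l i.val) := by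
  obtain ⟨T, hT, hT1⟩ :=
    exists_hilbertSeries_sup_span_singleton (hP.partialIdeal hl i.val) (hl i) (hreg i)
  refine ⟨G * (1 - Polynomial.X) + Polynomial.X * T, ?_, fun h => hT1 (by simpa using h)⟩
  rw [partialIdeal_succ, hT, hG]
  push_cast
  ring

lemma exists_hilbertSeries_partialIdeal (hP : IsHomogeneousIdeal P)
    (hl : ∀ i, (l i).IsHomogeneous 1) (hreg : IsFilterRegular P l) {i : ℕ} (hi : i ≤ s) :
    ∃ G : Polynomial ℤ, hilbertSeries (partialIdeal P l i) =
      hilbertSeries P * (1 - PowerSeries.X) ^ i + (G : PowerSeries ℤ) := by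
  induction i with
  | zero => exact ⟨0, by simp [partialIdeal_zero]⟩
  | succ i ih =>
    obtain ⟨G, hG⟩ := ih (Nat.le_of_succ_le hi)
    obtain ⟨G', hG', -⟩ := exists_hilbertSeries_partialIdeal_succ hP hl hreg ⟨i, hi⟩ hG
    exact ⟨G', hG'⟩

lemma IsParam.append {D : ℕ} {y : Fin D → MvPolynomial (Fin n) k}
    (hl : ∀ i, (l i).IsHomogeneous 1) (hy : IsParam (partialIdeal P l s) y) :
    IsParam P (Fin.append l y) := by
  refine ⟨fun j => ?_, hy.isIrrelevant.mono (sup_le (partialIdeal_le.2 ⟨le_sup_left, ?_⟩)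
    (Ideal.span_le.2 ?_))⟩
  · refine Fin.addCases (fun i => ?_) (fun i => ?_) j
    · rw [Fin.append_left]
      exact hl i
    · rw [Fin.append_right]
      exact hy.isHomogeneous i
  · exact fun p _ => Ideal.mem_sup_right (Ideal.subset_span ⟨p.castAdd D, Fin.append_left _ _ _⟩)
  · rintro _ ⟨p, rfl⟩
    exact Ideal.mem_sup_right (Ideal.subset_span ⟨p.natAdd s, Fin.append_right _ _ _⟩)

variable [Infinite k] {d : ℕ}

lemma exists_hilbertSeries_numerator (hP : IsHomogeneousIdeal P) (hne : P ≠ ⊤)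
    (hd : ringKrullDim (MvPolynomial (Fin n) k ⧸ P) = d) :
    ∃ q : Polynomial ℤ, (q : PowerSeries ℤ) = hilbertSeries P * (1 - PowerSeries.X) ^ d := by
  obtain ⟨D, hD, ⟨y, hy, -⟩, -⟩ := exists_isParam hP hne
  obtain rfl : D = d := by exact_mod_cast hD.symm.trans hd
  exact exists_polynomial_eq_hilbertSeries_mul hP hy.isHomogeneous hy.isIrrelevant

/-- Linear forms that change the Hilbert series only by a polynomial are part of a system of
parameters. -/
theorem ringKrullDim_partialIdeal (hP : IsHomogeneousIdeal P) (hne : P ≠ ⊤)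
    (hl : ∀ i, (l i).IsHomogeneous 1) (hd : ringKrullDim (MvPolynomial (Fin n) k ⧸ P) = d)
    (hsd : s ≤ d) {G : Polynomial ℤ} (hG : hilbertSeries (partialIdeal P l s) =
      hilbertSeries P * (1 - PowerSeries.X) ^ s + (G : PowerSeries ℤ)) :
    ringKrullDim (MvPolynomial (Fin n) k ⧸ partialIdeal P l s) = (d - s : ℕ) ∧
      ∀ f : MvPolynomial (Fin s) k, aeval l f ∈ P → f = 0 := by
  obtain ⟨q, hq⟩ := exists_hilbertSeries_numerator hP hne hd
  obtain ⟨D₀, hD₀, -, hmin⟩ := exists_isParam hP hne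
  obtain rfl : D₀ = d := by exact_mod_cast hD₀.symm.trans hd
  obtain ⟨D, hD, ⟨y, hy, hinj⟩, -⟩ :=
    exists_isParam (hP.partialIdeal hl s) (partialIdeal_ne_top hP hne hl s)
  have hparam := hy.append hl
  have hge : D₀ ≤ s + D := by
    by_contra! h
    exact hmin _ h _ hparam
  have hle : D ≤ D₀ - s := by
    refine le_of_hilbertSeries_mul hy.isHomogeneous hinj
      (q := q + G * (1 - Polynomial.X) ^ (D₀ - s)) ?_
    push_cast
    rw [hq, hG, add_mul, mul_assoc, ← pow_add, Nat.add_sub_cancel' hsd]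
  obtain rfl : D = D₀ - s := by omega
  refine ⟨hD, fun f hf => ?_⟩
  have happend : aeval (Fin.append l y) (rename (Fin.castAdd (D₀ - s)) f) = aeval l f := by
    rw [aeval_rename]
    exact congrArg (aeval · f) (funext fun i => Fin.append_left _ _ _)
  refine (map_eq_zero_iff _ (rename_injective _ (Fin.castAdd_injective s (D₀ - s)))).1
    (hparam.injective_of_minimal hP hne (fun D' hD' => hmin D' (by omega)) ?_)
  rwa [happend]

end FilterRegular

section HilbertCoeff

variable {k : Type*} [Field k] {n : ℕ}

lemma hilbertNumerator_eq {I : Ideal (MvPolynomial (Fin n) k)} {D : ℕ}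
    (hD : ringKrullDim (MvPolynomial (Fin n) k ⧸ I) = D) {q : Polynomial ℤ}
    (hq : (q : PowerSeries ℤ) = hilbertSeries I * (1 - PowerSeries.X) ^ D) :
    hilbertNumerator I = q := by
  obtain rfl : quotientDim I = D := by rw [quotientDim, hD]; rfl
  have hex : ∃ q : Polynomial ℤ,
      (q : PowerSeries ℤ) = hilbertSeries I * (1 - PowerSeries.X) ^ quotientDim I := ⟨q, hq⟩
  rw [hilbertNumerator, dif_pos hex]
  exact Polynomial.coe_injective _ (hex.choose_spec.trans hq.symm)

lemma coeff_taylor_one_add_mul_one_sub_X_pow {R : Type*} [CommRing R] (q G : Polynomial R)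
    {e i : ℕ} (hi : i ≤ e) :
    (Polynomial.taylor 1 (q + G * (1 - Polynomial.X) ^ e)).coeff i =
      (Polynomial.taylor 1 q).coeff i + if i = e then (-1) ^ e * G.eval 1 else 0 := by
  have hX : Polynomial.taylor 1 (1 - Polynomial.X : Polynomial R) =
      Polynomial.C (-1) * Polynomial.X := by
    simp [Polynomial.taylor_apply]
  rw [map_add, Polynomial.coeff_add, Polynomial.taylor_mul, Polynomial.taylor_pow, hX, mul_pow,
    ← mul_assoc, Polynomial.coeff_mul_X_pow', ← Polynomial.C_pow, Polynomial.coeff_mul_C]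
  congr 1
  rcases hi.eq_or_lt with rfl | h
  · rw [if_pos le_rfl, if_pos rfl, Nat.sub_self, Polynomial.taylor_coeff_zero, mul_comm]
  · rw [if_neg (by omega), if_neg h.ne]

theorem hilbertCoeff_partialIdeal [Infinite k] {s d : ℕ} {P : Ideal (MvPolynomial (Fin n) k)}
    (hP : IsHomogeneousIdeal P) (hne : P ≠ ⊤)
    (hd : ringKrullDim (MvPolynomial (Fin n) k ⧸ P) = d) (hsd : s ≤ d)
    {l : Fin s → MvPolynomial (Fin n) k} (hl : ∀ i, (l i).IsHomogeneous 1) {G : Polynomial ℤ}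
    (hG : hilbertSeries (partialIdeal P l s) =
      hilbertSeries P * (1 - PowerSeries.X) ^ s + (G : PowerSeries ℤ)) {i : ℕ} (hi : i ≤ d - s) :
    hilbertCoeff (partialIdeal P l s) i =
      hilbertCoeff P i + if i = d - s then (-1) ^ (d - s) * G.eval 1 else 0 := by
  obtain ⟨q, hq⟩ := exists_hilbertSeries_numerator hP hne hd
  have hnum : hilbertNumerator (partialIdeal P l s) = q + G * (1 - Polynomial.X) ^ (d - s) := by
    refine hilbertNumerator_eq (ringKrullDim_partialIdeal hP hne hl hd hsd hG).1 ?_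
    push_cast
    rw [hq, hG, add_mul, mul_assoc, ← pow_add, Nat.add_sub_cancel' hsd]
  rw [hilbertCoeff, hilbertCoeff, hnum, hilbertNumerator_eq hd hq,
    coeff_taylor_one_add_mul_one_sub_X_pow _ _ hi]

end HilbertCoeff

section TotalDegree

variable (k : Type*) [Field k]

lemma finrank_restrictTotalDegree (s i : ℕ) :
    Module.finrank k (restrictTotalDegree (Fin s) k i) = Nat.multichoose (s + 1) i := by
  set E : Finset (Fin s →₀ ℕ) := (Finset.range (i + 1)).biUnion Finset.univ.finsuppAntidiag with hE
  have hrestrict : restrictTotalDegree (Fin s) k i = restrictSupport k (E : Set (Fin s →₀ ℕ)) := by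
    rw [restrictTotalDegree]
    congr 1
    ext α
    simp [hE, Finset.mem_finsuppAntidiag, Finsupp.sum_fintype]
  have hcard : E.card = ∑ a ∈ Finset.range (i + 1), Nat.multichoose s a := by
    have hdisj : ∀ a b, a ≠ b → Disjoint (Finset.univ.finsuppAntidiag a : Finset (Fin s →₀ ℕ))
        (Finset.univ.finsuppAntidiag b) := fun a b hab => Finset.disjoint_left.2 fun α ha hb =>
      hab ((Finset.mem_finsuppAntidiag.1 ha).1.symm.trans (Finset.mem_finsuppAntidiag.1 hb).1)
    rw [hE, Finset.card_biUnion fun a _ b _ => hdisj a b]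
    simp only [Finset.card_finsuppAntidiag_nat_eq_multichoose, Finset.card_univ, Fintype.card_fin]
  rw [hrestrict, Module.finrank_eq_nat_card_basis (basisRestrictSupport k _), Nat.card_coe_set_eq,
    Set.ncard_coe_finset, hcard, Nat.sum_range_multichoose, Nat.multichoose_eq,
    show s + 1 + i - 1 = i + s by omega, Nat.choose_symm_add]

variable {k} {n : ℕ}

lemma sum_hilbertFunction_le {I : Ideal (MvPolynomial (Fin n) k)} (hI : IsHomogeneousIdeal I)
    (m : ℕ) : ∑ j ∈ Finset.range (m + 1), hilbertFunction I j ≤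
      Module.finrank k
        ((restrictTotalDegree (Fin n) k m).map (Ideal.Quotient.mkₐ k I).toLinearMap) := by
  set μ := (Ideal.Quotient.mkₐ k I).toLinearMap
  have hle : ∀ m, homogeneousSubmodule (Fin n) k m ≤ restrictTotalDegree (Fin n) k m :=
    fun m f hf => (mem_restrictTotalDegree _ _ _).2 (IsHomogeneous.totalDegree_le hf)
  induction m with
  | zero =>
    rw [Finset.sum_range_one]
    exact Submodule.finrank_mono (Submodule.map_mono (hle 0))
  | succ m ih =>
    have hdisj : (restrictTotalDegree (Fin n) k m).map μ ⊓
        (homogeneousSubmodule (Fin n) k (m + 1)).map μ = ⊥ := by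
      rw [eq_bot_iff]
      rintro _ ⟨⟨f, hf, rfl⟩, ⟨g, hg, hfg⟩⟩
      have hsub : g - f ∈ I := Ideal.Quotient.eq.1 hfg
      have hcomp := isHomogeneousIdeal_iff.1 hI _ hsub (m + 1)
      rw [map_sub, homogeneousComponent_eq_self hg, homogeneousComponent_eq_zero _ _
        (Nat.lt_succ_of_le ((mem_restrictTotalDegree _ _ _).1 hf)), sub_zero] at hcomp
      rw [Submodule.mem_bot, ← hfg]
      exact Ideal.Quotient.eq_zero_iff_mem.2 hcomp
    have hmono : restrictTotalDegree (Fin n) k m ≤ restrictTotalDegree (Fin n) k (m + 1) :=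
      fun f hf => (mem_restrictTotalDegree _ _ _).2
        (Nat.le_succ_of_le ((mem_restrictTotalDegree _ _ _).1 hf))
    have hfin := Submodule.finrank_sup_add_finrank_inf_eq
      ((restrictTotalDegree (Fin n) k m).map μ) ((homogeneousSubmodule (Fin n) k (m + 1)).map μ)
    rw [hdisj, finrank_bot, add_zero, ← Submodule.map_sup] at hfin
    rw [Finset.sum_range_succ]
    exact (Nat.add_le_add_right ih _).trans
      (hfin.ge.trans (Submodule.finrank_mono (Submodule.map_mono (sup_le hmono (hle _)))))

end TotalDegree

section RankOne

lemma exists_smul_add_smul_eq_zero_of_rank_le_one {R M : Type*} [Ring R] [Nontrivial R]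
    [AddCommGroup M] [Module R M] (h : Module.rank R M ≤ 1) (v w : M) :
    ∃ ρ σ : R, ρ • v + σ • w = 0 ∧ (ρ = 0 → σ ≠ 0) := by
  by_contra! hind
  have hcard := (LinearIndependent.pair_iff.2 hind).cardinal_lift_le_rank.trans
    (Cardinal.lift_le.2 h)
  norm_num at hcard

variable {R B : Type*} [CommRing R] [UniqueFactorizationMonoid R]

lemma exists_smul_primitive {z : B →₀ R} (hz : z ≠ 0) :
    ∃ (c : R) (w : B →₀ R), z = c • w ∧ ∀ ρ σ : R, (∀ b, ρ ∣ σ * w b) → ρ ∣ σ := by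
  classical
  let _ : StrongNormalizationMonoid R := UniqueFactorizationMonoid.strongNormalizationMonoid
  let _ : NormalizedGCDMonoid R := UniqueFactorizationMonoid.toNormalizedGCDMonoid R
  obtain ⟨g, hg, hg1⟩ := Finset.extract_gcd z (Finsupp.support_nonempty_iff.2 hz)
  refine ⟨z.support.gcd z, Finsupp.indicator z.support fun b _ => g b, ?_, fun ρ σ h => ?_⟩
  · ext b
    rw [Finsupp.smul_apply, smul_eq_mul]
    by_cases hb : b ∈ z.support
    · rw [Finsupp.indicator_of_mem hb, hg b hb]
    · rw [Finsupp.indicator_of_notMem hb, mul_zero, Finsupp.notMem_support_iff.1 hb]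
  · have hdvd : ρ ∣ z.support.gcd fun b => σ * g b := Finset.dvd_gcd fun b hb => by
      simpa only [Finsupp.indicator_of_mem hb] using h b
    have hgcd := (Finset.gcd_mul_left' (s := z.support) (f := g) (a := σ)).dvd
    rw [hg1, mul_one] at hgcd
    exact hdvd.trans hgcd

lemma isPrincipal_of_saturated_of_rank_le_one [IsDomain R] {Z : Submodule R (B →₀ R)}
    (hsat : ∀ ρ : R, ρ ≠ 0 → ∀ v, ρ • v ∈ Z → v ∈ Z) (hrank : Module.rank R Z ≤ 1) :
    Z.IsPrincipal := by
  by_cases hZ : Z = ⊥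
  · exact hZ ▸ bot_isPrincipal
  obtain ⟨z, hz, hz0⟩ := Submodule.exists_mem_ne_zero_of_ne_bot hZ
  obtain ⟨c, w, rfl, hw⟩ := exists_smul_primitive hz0
  have hwZ : w ∈ Z := hsat c (left_ne_zero_of_smul hz0) _ hz
  refine ⟨w, le_antisymm (fun v hv => ?_) ((Submodule.span_singleton_le_iff_mem _ _).2 hwZ)⟩
  obtain ⟨ρ, σ, hrel, hne⟩ :=
    exists_smul_add_smul_eq_zero_of_rank_le_one (R := R) (M := Z) hrank ⟨v, hv⟩ ⟨w, hwZ⟩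
  replace hrel : ρ • v + σ • w = 0 := congrArg Subtype.val hrel
  have hρ : ρ ≠ 0 := by
    rintro rfl
    rw [zero_smul, zero_add, smul_eq_zero] at hrel
    exact hrel.elim (hne rfl) (right_ne_zero_of_smul hz0)
  obtain ⟨d, rfl⟩ := hw ρ σ fun b => by
    have hb := DFunLike.congr_fun hrel b
    simp only [Finsupp.add_apply, Finsupp.smul_apply, smul_eq_mul, Finsupp.zero_apply] at hb
    exact ⟨-v b, by linear_combination hb⟩
  rw [mul_smul, ← smul_add, smul_eq_zero_iff_right hρ] at hrel
  exact Submodule.mem_span_singleton.2 ⟨-d, by rw [neg_smul, eq_neg_of_add_eq_zero_left hrel]⟩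

end RankOne

section VariableIdeal

variable {k : Type*} [Field k] {s : ℕ}

variable (k s) in
/-- The ideal generated by the first `j` variables. -/
def variableIdeal (j : ℕ) : Ideal (MvPolynomial (Fin s) k) := partialIdeal ⊥ X j

variable (k s) in
/-- The substitution of zero for the first `j` variables. -/
def killVars (j : ℕ) : MvPolynomial (Fin s) k →ₐ[k] MvPolynomial (Fin s) k :=
  aeval fun p => if p.val < j then 0 else X p

lemma ker_killVars (j : ℕ) : RingHom.ker (killVars k s j) = variableIdeal k s j := by
  apply le_antisymm
  · have hcomp : (Ideal.Quotient.mkₐ k (variableIdeal k s j)).comp (killVars k s j) =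
        Ideal.Quotient.mkₐ k (variableIdeal k s j) := by
      apply algHom_ext
      intro p
      rw [AlgHom.comp_apply, killVars, aeval_X]
      split_ifs with hp
      · rw [map_zero]
        exact (Ideal.Quotient.eq_zero_iff_mem.2 (mem_partialIdeal _ _ hp)).symm
      · rfl
    intro f hf
    have hf' := DFunLike.congr_fun hcomp f
    rw [AlgHom.comp_apply, RingHom.mem_ker.1 hf, map_zero] at hf'
    exact Ideal.Quotient.eq_zero_iff_mem.1 hf'.symm
  · refine partialIdeal_le.2 ⟨bot_le, fun p hp => ?_⟩
    rw [RingHom.mem_ker, killVars, aeval_X, if_pos hp]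

lemma isPrime_variableIdeal (j : ℕ) : (variableIdeal k s j).IsPrime :=
  ker_killVars (k := k) (s := s) j ▸ RingHom.ker_isPrime _

lemma X_notMem_variableIdeal (p : Fin s) : X p ∉ variableIdeal k s p.val := by
  rw [← ker_killVars, RingHom.mem_ker, killVars, aeval_X, if_neg (lt_irrefl _)]
  exact X_ne_zero p

lemma mem_variableIdeal_of_X_mul_mem {p : Fin s} {ρ : MvPolynomial (Fin s) k}
    (h : X p * ρ ∈ variableIdeal k s p.val) : ρ ∈ variableIdeal k s p.val :=
  ((isPrime_variableIdeal _).mem_or_mem h).resolve_left (X_notMem_variableIdeal p)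

lemma variableIdeal_succ (p : Fin s) :
    variableIdeal k s (p.val + 1) = variableIdeal k s p.val ⊔ Ideal.span {X p} :=
  partialIdeal_succ ⊥ X p

lemma variableIdeal_mono : Monotone (variableIdeal k s) := fun _ _ h =>
  partialIdeal_le.2 ⟨bot_le, fun _ hp => mem_partialIdeal _ _ (hp.trans_le h)⟩

end VariableIdeal

section Presentation

variable {k : Type*} [Field k] {n s : ℕ} {B : Type*} (l : Fin s → MvPolynomial (Fin n) k)
  (e : B → MvPolynomial (Fin n) k)

/-- The semilinear map from a free module over `k[y₁, …, y_s]` to `S` given by `y_i ↦ l_i` and the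
family `e` of elements of `S`. -/
def presentation : (B →₀ MvPolynomial (Fin s) k) →ₗ[k] MvPolynomial (Fin n) k :=
  Finsupp.lsum k fun b => LinearMap.mulRight k (e b) ∘ₗ (aeval l).toLinearMap

lemma presentation_single (b : B) (ρ : MvPolynomial (Fin s) k) :
    presentation l e (Finsupp.single b ρ) = aeval l ρ * e b := by
  simp [presentation]

lemma presentation_smul (ρ : MvPolynomial (Fin s) k) (v : B →₀ MvPolynomial (Fin s) k) :
    presentation l e (ρ • v) = aeval l ρ * presentation l e v := by
  induction v using Finsupp.induction_linear with
  | zero => rw [smul_zero, map_zero, mul_zero]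
  | add v w hv hw => rw [smul_add, map_add, map_add, hv, hw, mul_add]
  | single b σ =>
    rw [Finsupp.smul_single, presentation_single, presentation_single, smul_eq_mul, map_mul,
      mul_assoc]

/-- The module of relations, over `k[y₁, …, y_s]`, between the residue classes of the `e b` in
`S/P`. -/
def relations (P : Ideal (MvPolynomial (Fin n) k)) :
    Submodule (MvPolynomial (Fin s) k) (B →₀ MvPolynomial (Fin s) k) where
  carrier := {v | presentation l e v ∈ P}
  zero_mem' := by simp
  add_mem' hv hw := by
    rw [Set.mem_ofPred_eq, map_add]
    exact P.add_mem hv hw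
  smul_mem' ρ v hv := by
    rw [Set.mem_ofPred_eq, presentation_smul]
    exact P.mul_mem_left _ hv

variable {l e} {P : Ideal (MvPolynomial (Fin n) k)}

lemma mem_relations {v : B →₀ MvPolynomial (Fin s) k} :
    v ∈ relations l e P ↔ presentation l e v ∈ P := Iff.rfl

lemma presentation_mem_partialIdeal {j : ℕ} {v : B →₀ MvPolynomial (Fin s) k}
    (hv : ∀ b, v b ∈ variableIdeal k s j) : presentation l e v ∈ partialIdeal P l j := by
  have hle : variableIdeal k s j ≤ (partialIdeal P l j).comap (aeval l) := by
    refine partialIdeal_le.2 ⟨bot_le, fun p hp => ?_⟩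
    rw [Ideal.mem_comap, aeval_X]
    exact mem_partialIdeal P l hp
  rw [presentation, Finsupp.lsum_apply]
  exact Ideal.sum_mem _ fun b _ => Ideal.mul_mem_right _ _ (hle (hv b))

variable (hsurj : ∀ f, ∃ v, f - presentation l e v ∈ P)
include hsurj

lemma exists_presentation_of_mem_partialIdeal {j : ℕ} (hj : j ≤ s)
    {f : MvPolynomial (Fin n) k} (hf : f ∈ partialIdeal P l j) :
    ∃ v, (∀ b, v b ∈ variableIdeal k s j) ∧ f - presentation l e v ∈ P := by
  induction j generalizing f with
  | zero =>
    rw [partialIdeal_zero] at hf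
    exact ⟨0, fun _ => Ideal.zero_mem _, by simpa using hf⟩
  | succ j ih =>
    rw [partialIdeal_succ P l ⟨j, hj⟩] at hf
    obtain ⟨f', hf', _, hg, rfl⟩ := Submodule.mem_sup.1 hf
    obtain ⟨g, rfl⟩ := Ideal.mem_span_singleton'.1 hg
    obtain ⟨v, hv, hfv⟩ := ih (Nat.le_of_succ_le hj) hf'
    obtain ⟨u, hu⟩ := hsurj g
    refine ⟨v + (X ⟨j, hj⟩ : MvPolynomial (Fin s) k) • u, fun b => ?_, ?_⟩
    · rw [variableIdeal_succ ⟨j, hj⟩]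
      exact add_mem (Ideal.mem_sup_left (hv b)) (Ideal.mem_sup_right
        (Ideal.mul_mem_right _ _ (Ideal.mem_span_singleton_self _)))
    · rw [map_add, presentation_smul, aeval_X]
      convert add_mem hfv (P.mul_mem_left (l ⟨j, hj⟩) hu) using 1
      ring

lemma exists_lift_of_mem_colon {w : B →₀ MvPolynomial (Fin s) k}
    (hw : relations l e P = Submodule.span _ {w}) {i : Fin s} {f : MvPolynomial (Fin n) k}
    (hf : f ∈ (partialIdeal P l i.val).colon {l i}) :
    ∃ (v : B →₀ MvPolynomial (Fin s) k) (ρ : MvPolynomial (Fin s) k),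
      f - presentation l e v ∈ P ∧ ∀ b, X i * v b - ρ * w b ∈ variableIdeal k s i.val := by
  rw [Submodule.mem_colon_singleton, smul_eq_mul] at hf
  obtain ⟨v, hv⟩ := hsurj f
  obtain ⟨u, hu, hfu⟩ := exists_presentation_of_mem_partialIdeal hsurj i.2.le hf
  have hrel : (X i : MvPolynomial (Fin s) k) • v - u ∈ relations l e P := by
    rw [mem_relations, map_sub, presentation_smul, aeval_X]
    convert sub_mem hfu (P.mul_mem_left (l i) hv) using 1
    ring
  rw [hw, Submodule.mem_span_singleton] at hrel
  obtain ⟨ρ, hρ⟩ := hrel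
  refine ⟨v, ρ, hv, fun b => ?_⟩
  have hb := DFunLike.congr_fun hρ b
  simp only [Finsupp.sub_apply, Finsupp.smul_apply, smul_eq_mul] at hb
  rw [hb, sub_sub_cancel]
  exact hu b

lemma exists_notMem_variableIdeal_of_relations_eq_span {w : B →₀ MvPolynomial (Fin s) k}
    (hw : relations l e P = Submodule.span _ {w}) {t : Fin s}
    (ht : ¬ (partialIdeal P l t.val).colon {l t} ≤ partialIdeal P l t.val) :
    ∃ b, w b ∉ variableIdeal k s t.val := by
  by_contra! hwt
  refine ht fun f hf => ?_
  obtain ⟨v, ρ, hv, hvb⟩ := exists_lift_of_mem_colon hsurj hw hf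
  have hvt : ∀ b, v b ∈ variableIdeal k s t.val := fun b =>
    mem_variableIdeal_of_X_mul_mem
      ((Submodule.sub_mem_iff_left _ (Ideal.mul_mem_left _ ρ (hwt b))).1 (hvb b))
  exact (Submodule.sub_mem_iff_left _ (presentation_mem_partialIdeal hvt)).1
    (Ideal.mem_sup_left hv)

/-- Modulo `y₁, …, yᵢ₊₁` the relation `yᵢ₊₁ v ≡ ρ w` says `ρ w ≡ 0`; as `w` does not vanish there,
`ρ` is a multiple of `yᵢ₊₁` modulo `y₁, …, yᵢ`. -/
lemma colon_le_partialIdeal_of_relations_eq_span {w : B →₀ MvPolynomial (Fin s) k}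
    (hw : relations l e P = Submodule.span _ {w}) {t : Fin s}
    (ht : ¬ (partialIdeal P l t.val).colon {l t} ≤ partialIdeal P l t.val) {i : Fin s}
    (hi : i < t) : (partialIdeal P l i.val).colon {l i} ≤ partialIdeal P l i.val := by
  intro f hf
  obtain ⟨v, ρ, hv, hvb⟩ := exists_lift_of_mem_colon hsurj hw hf
  have hρ : ρ ∈ variableIdeal k s i.val ⊔ Ideal.span {X i} := by
    rw [← variableIdeal_succ]
    obtain ⟨b, hb⟩ := exists_notMem_variableIdeal_of_relations_eq_span hsurj hw ht
    have hmem : ρ * w b ∈ variableIdeal k s (i.val + 1) := by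
      rw [variableIdeal_succ]
      exact (Submodule.sub_mem_iff_right _ (Ideal.mem_sup_right (Ideal.mul_mem_right _ _
        (Ideal.mem_span_singleton_self _)))).1 (Ideal.mem_sup_left (hvb b))
    exact ((isPrime_variableIdeal _).mem_or_mem hmem).resolve_right
      fun h => hb (variableIdeal_mono (Nat.succ_le_of_lt hi) h)
  obtain ⟨ρ', hρ', _, hc, rfl⟩ := Submodule.mem_sup.1 hρ
  obtain ⟨c, rfl⟩ := Ideal.mem_span_singleton'.1 hc
  have hvc : ∀ b, (v - c • w) b ∈ variableIdeal k s i.val := fun b => by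
    refine mem_variableIdeal_of_X_mul_mem ?_
    convert add_mem (hvb b) (Ideal.mul_mem_right (w b) _ hρ') using 1
    rw [Finsupp.sub_apply, Finsupp.smul_apply, smul_eq_mul]
    ring
  have hcw : presentation l e (c • w) ∈ P :=
    mem_relations.1 (hw ▸ Submodule.mem_span_singleton.2 ⟨c, rfl⟩)
  have hsplit : f = presentation l e (v - c • w) + (presentation l e (c • w) +
      (f - presentation l e v)) := by
    rw [map_sub]
    ring
  rw [hsplit]
  exact add_mem (presentation_mem_partialIdeal hvc) (Ideal.mem_sup_left (add_mem hcw hv))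

end Presentation

section DegreeFiltration

variable {k : Type*} [Field k] {s : ℕ} {B : Type*} {deg : B → ℕ}

variable (k s deg) in
/-- The elements of degree at most `m` of the free module over `k[y₁, …, y_s]` on generators `b`
of degree `deg b`. -/
def degreeLE (m : ℕ) : Submodule k (B →₀ MvPolynomial (Fin s) k) where
  carrier := {v | ∀ b, v b ≠ 0 → deg b + (v b).totalDegree ≤ m}
  zero_mem' _ h := absurd rfl h
  add_mem' {v w} hv hw b hb := by
    rw [Finsupp.add_apply] at hb ⊢
    by_cases hvb : v b = 0
    · rw [hvb, zero_add] at hb ⊢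
      exact hw b hb
    by_cases hwb : w b = 0
    · rw [hwb, add_zero]
      exact hv b hvb
    have hadd := totalDegree_add (v b) (w b)
    have := hv b hvb
    have := hw b hwb
    omega
  smul_mem' c v hv b hb := by
    rw [Finsupp.smul_apply] at hb ⊢
    exact (Nat.add_le_add_left (totalDegree_smul_le _ _) _).trans
      (hv b (right_ne_zero_of_smul hb))

lemma degreeLE_mono : Monotone (degreeLE k s deg) :=
  fun _ _ h _ hv b hb => (hv b hb).trans h

lemma single_mem_degreeLE {m : ℕ} {b : B} {ρ : MvPolynomial (Fin s) k}
    (h : deg b + ρ.totalDegree ≤ m) : Finsupp.single b ρ ∈ degreeLE k s deg m := by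
  intro b' hb'
  obtain rfl | hne := eq_or_ne b b'
  · rwa [Finsupp.single_eq_same]
  · exact absurd (Finsupp.single_eq_of_ne' hne) hb'

lemma smul_mem_degreeLE {i m : ℕ} {ρ : MvPolynomial (Fin s) k} (hρ : ρ.totalDegree ≤ i)
    {v : B →₀ MvPolynomial (Fin s) k} (hv : v ∈ degreeLE k s deg m) :
    ρ • v ∈ degreeLE k s deg (m + i) := by
  intro b hb
  rw [Finsupp.smul_apply] at hb ⊢
  have hmul := totalDegree_mul ρ (v b)
  have hvb := hv b (right_ne_zero_of_smul hb)
  rw [smul_eq_mul]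
  omega

lemma exists_mem_degreeLE (v : B →₀ MvPolynomial (Fin s) k) : ∃ m, v ∈ degreeLE k s deg m :=
  ⟨_, fun _ hb => Finset.le_sup (f := fun b => deg b + (v b).totalDegree)
    (Finsupp.mem_support_iff.2 hb)⟩

variable {a : ℕ → ℕ}

variable (k s a) in
/-- The coordinates of an element of degree at most `m`, in the free module with `a j` generators
of degree `j`. -/
def degreeLECoord (m : ℕ) : degreeLE k s (Sigma.fst : (Σ j, Fin (a j)) → ℕ) m →ₗ[k]
    ∀ p : Σ j : Fin (m + 1), Fin (a j), restrictTotalDegree (Fin s) k (m - p.1) :=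
  LinearMap.pi fun p =>
    (Finsupp.lapply ⟨p.1, p.2⟩ ∘ₗ Submodule.subtype _).codRestrict _ fun v => by
      rw [mem_restrictTotalDegree]
      change (v.1 ⟨p.1, p.2⟩).totalDegree ≤ m - p.1
      by_cases h : v.1 ⟨p.1, p.2⟩ = 0
      · rw [h, totalDegree_zero]
        exact Nat.zero_le _
      · exact Nat.le_sub_of_add_le' (v.2 _ h)

lemma degreeLECoord_injective (m : ℕ) : Function.Injective (degreeLECoord k s a m) := by
  refine (injective_iff_map_eq_zero _).2 fun v hv => Subtype.ext (Finsupp.ext fun b => ?_)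
  by_contra hb
  have hbm : b.1 < m + 1 := by
    have := v.2 b hb
    omega
  exact hb (congrArg Subtype.val (congrFun hv ⟨⟨b.1, hbm⟩, b.2⟩))

instance finiteDimensional_degreeLE (m : ℕ) :
    FiniteDimensional k (degreeLE k s (Sigma.fst : (Σ j, Fin (a j)) → ℕ) m) :=
  Module.Finite.of_injective _ (degreeLECoord_injective m)

lemma finrank_degreeLE_le (m : ℕ) :
    Module.finrank k (degreeLE k s (Sigma.fst : (Σ j, Fin (a j)) → ℕ) m) ≤
      ∑ j ∈ Finset.range (m + 1), a j * Nat.multichoose (s + 1) (m - j) := by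
  refine (LinearMap.finrank_le_finrank_of_injective (degreeLECoord_injective m)).trans_eq ?_
  rw [Module.finrank_pi_fintype, Fintype.sum_sigma, Finset.sum_range]
  simp only [finrank_restrictTotalDegree, Finset.sum_const, Finset.card_univ, Fintype.card_fin,
    smul_eq_mul]

end DegreeFiltration

section RelationCount

variable {k : Type*} [Field k] {s : ℕ}

lemma card_mul_multichoose_le_finrank {ι M : Type*} [Fintype ι] [AddCommGroup M] [Module k M]
    [Module (MvPolynomial (Fin s) k) M] [IsScalarTower k (MvPolynomial (Fin s) k) M]
    {z : ι → M} (hz : LinearIndependent (MvPolynomial (Fin s) k) z) {d : ℕ} {W : Submodule k M}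
    [FiniteDimensional k W]
    (hW : ∀ i, ∀ ρ : MvPolynomial (Fin s) k, ρ.totalDegree ≤ d → ρ • z i ∈ W) :
    Fintype.card ι * Nat.multichoose (s + 1) d ≤ Module.finrank k W := by
  set V := restrictTotalDegree (Fin s) k d with hV
  let θ : (ι → V) →ₗ[k] M :=
    (Fintype.linearCombination (MvPolynomial (Fin s) k) z).restrictScalars k ∘ₗ
      V.subtype.compLeft ι
  have hθ : Function.Injective θ :=
    (linearIndependent_iff_injective_fintypeLinearCombination.1 hz).comp
      (Subtype.val_injective.comp_left)
  have hθW : ∀ u, θ u ∈ W := fun u => sum_mem fun i _ =>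
    hW i _ ((mem_restrictTotalDegree _ _ _).1 (u i).2)
  have hfin := LinearMap.finrank_le_finrank_of_injective (f := θ.codRestrict W hθW)
    fun u v huv => hθ (congrArg Subtype.val huv)
  rwa [Module.finrank_pi_fintype, Finset.sum_const, Finset.card_univ, hV,
    finrank_restrictTotalDegree, smul_eq_mul] at hfin

lemma rank_submodule_le {R M : Type*} [Ring R] [AddCommGroup M] [Module R M] {Z : Submodule R M}
    {q : ℕ} (hZ : ∀ T : Finset Z, LinearIndependent R (fun z : T => z.1.1) → T.card ≤ q) :
    Module.rank R Z ≤ q :=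
  rank_le fun T hT => hZ T (hT.map' Z.subtype Z.ker_subtype)

lemma exists_card_mul_multichoose_le_finrank_degreeLE_inf {a : ℕ → ℕ}
    {Z : Submodule (MvPolynomial (Fin s) k) ((Σ j, Fin (a j)) →₀ MvPolynomial (Fin s) k)}
    {T : Finset Z} (hT : LinearIndependent (MvPolynomial (Fin s) k) fun z : T => z.1.1) :
    ∃ c, ∀ m, c ≤ m → T.card * Nat.multichoose (s + 1) (m - c) ≤
      Module.finrank k (degreeLE k s Sigma.fst m ⊓ Z.restrictScalars k : Submodule k _) := by
  choose d hd using fun z : Z => exists_mem_degreeLE (deg := Sigma.fst) z.1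
  refine ⟨T.sup d, fun m hm => ?_⟩
  rw [← Fintype.card_coe]
  refine card_mul_multichoose_le_finrank hT fun z ρ hρ => ⟨?_, ?_⟩
  · have hz := smul_mem_degreeLE hρ (degreeLE_mono (Finset.le_sup z.2) (hd z.1))
    rwa [Nat.add_sub_cancel' hm] at hz
  · exact Submodule.smul_mem _ _ z.1.2

lemma le_eval_one_of_sum_le {h p : ℕ → ℕ} {c q : ℕ} {G : Polynomial ℤ}
    (hG : (PowerSeries.mk fun m => (h m : ℤ)) =
      (PowerSeries.mk fun m => (p m : ℤ)) * (1 - PowerSeries.X) ^ s + (G : PowerSeries ℤ))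
    (hle : ∀ m, (∑ j ∈ Finset.range (m + 1), p j) +
      (if c ≤ m then q * Nat.multichoose (s + 1) (m - c) else 0) ≤
        ∑ j ∈ Finset.range (m + 1), h j * Nat.multichoose (s + 1) (m - j)) :
    q ≤ G.eval 1 := by
  set H : PowerSeries ℤ := PowerSeries.mk fun m => (h m : ℤ) with hH
  set N : PowerSeries ℤ := PowerSeries.mk fun m => (Nat.multichoose (s + 1) m : ℤ) with hN
  set S : PowerSeries ℤ :=
    PowerSeries.mk fun m => ∑ j ∈ Finset.range (m + 1), (p j : ℤ) with hS
  have hN1 : N * (1 - PowerSeries.X) ^ (s + 1) = 1 := mk_multichoose_mul_one_sub_X_pow (s + 1)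
  have hS1 : S * (1 - PowerSeries.X) = PowerSeries.mk fun m => (p m : ℤ) :=
    mk_sum_range_mul_one_sub_X _
  have hnonneg := eval_one_nonneg_of_coeff_nonneg (g := G - (q : Polynomial ℤ) * Polynomial.X ^ c)
    (D := s + 1) (H := H * N - S - (q : PowerSeries ℤ) * (PowerSeries.X ^ c * N)) ?_ fun m => ?_
  · simpa using hnonneg
  · rw [Polynomial.coe_sub, Polynomial.coe_mul, Polynomial.coe_pow, Polynomial.coe_X,
      show ((q : Polynomial ℤ) : PowerSeries ℤ) = q from
        map_natCast Polynomial.coeToPowerSeries.ringHom q]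
    linear_combination (H - (q : PowerSeries ℤ) * PowerSeries.X ^ c) * hN1 -
      (1 - PowerSeries.X) ^ s * hS1 + hG
  · have hHN : PowerSeries.coeff m (H * N) =
        ∑ j ∈ Finset.range (m + 1), (h j : ℤ) * Nat.multichoose (s + 1) (m - j) := by
      rw [PowerSeries.coeff_mul, Finset.Nat.sum_antidiagonal_eq_sum_range_succ_mk]
      simp only [hH, hN, PowerSeries.coeff_mk]
    have hqN : PowerSeries.coeff m ((q : PowerSeries ℤ) * (PowerSeries.X ^ c * N)) =
        if c ≤ m then q * (Nat.multichoose (s + 1) (m - c) : ℤ) else 0 := by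
      rw [← map_natCast (PowerSeries.C (R := ℤ)), PowerSeries.coeff_C_mul,
        PowerSeries.coeff_X_pow_mul', mul_ite, mul_zero, hN, PowerSeries.coeff_mk]
    rw [map_sub, map_sub, hHN, hqN, hS, PowerSeries.coeff_mk]
    have hm : ((∑ j ∈ Finset.range (m + 1), (p j : ℤ)) +
        if c ≤ m then q * (Nat.multichoose (s + 1) (m - c) : ℤ) else 0) ≤
          ∑ j ∈ Finset.range (m + 1), (h j : ℤ) * Nat.multichoose (s + 1) (m - j) := by
      exact_mod_cast hle m
    linarith

end RelationCount

section GradedSpanning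

variable {k : Type*} [Field k] {n s : ℕ} {a : ℕ → ℕ}

/-- The forms `e ⟨m, i⟩`, of degree `m`, span `S/J` over `k`. -/
structure IsGradedSpanning (J : Ideal (MvPolynomial (Fin n) k))
    (e : (Σ m, Fin (a m)) → MvPolynomial (Fin n) k) : Prop where
  isHomogeneous : ∀ b, (e b).IsHomogeneous b.1
  exists_sub_sum_mem : ∀ m f, f.IsHomogeneous m →
    ∃ c : Fin (a m) → k, f - ∑ i, c i • e ⟨m, i⟩ ∈ J

lemma exists_isGradedSpanning (J : Ideal (MvPolynomial (Fin n) k)) :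
    ∃ e : (Σ m, Fin (hilbertFunction J m)) → MvPolynomial (Fin n) k, IsGradedSpanning J e := by
  set μ := (Ideal.Quotient.mkₐ k J).toLinearMap
  let bas := fun m => Module.finBasis k ((homogeneousSubmodule (Fin n) k m).map μ)
  have hlift : ∀ b : (Σ m, Fin (hilbertFunction J m)), ∃ f : MvPolynomial (Fin n) k,
      f.IsHomogeneous b.1 ∧ μ f = (bas b.1 b.2).1 := fun b => (bas b.1 b.2).2
  choose e he hμ using hlift
  refine ⟨e, he, fun m f hf => ?_⟩
  set x : (homogeneousSubmodule (Fin n) k m).map μ := ⟨μ f, f, hf, rfl⟩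
  refine ⟨(bas m).repr x, Ideal.Quotient.eq.1 ?_⟩
  have hsum := congrArg Subtype.val ((bas m).sum_repr x)
  rw [Submodule.coe_sum] at hsum
  calc μ f = ∑ i, (bas m).repr x i • (bas m i).1 := hsum.symm
    _ = ∑ i, μ ((bas m).repr x i • e ⟨m, i⟩) :=
        Finset.sum_congr rfl fun i _ => by rw [map_smul, hμ ⟨m, i⟩]
    _ = μ (∑ i, (bas m).repr x i • e ⟨m, i⟩) := (map_sum μ _ _).symm

variable {P : Ideal (MvPolynomial (Fin n) k)} {l : Fin s → MvPolynomial (Fin n) k}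
  {e : (Σ m, Fin (a m)) → MvPolynomial (Fin n) k}

lemma IsGradedSpanning.mem_map_degreeLE
    (he : IsGradedSpanning (P ⊔ Ideal.span (Set.range l)) e) (hP : IsHomogeneousIdeal P)
    (hl : ∀ i, (l i).IsHomogeneous 1) {m : ℕ} {f : MvPolynomial (Fin n) k}
    (hf : f.totalDegree ≤ m) :
    f ∈ (degreeLE k s Sigma.fst m).map (presentation l e) ⊔ P.restrictScalars k := by
  set M : ℕ → Submodule k (MvPolynomial (Fin n) k) := fun m =>
    (degreeLE k s Sigma.fst m).map (presentation l e) ⊔ P.restrictScalars k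
  have hM : Monotone M := fun _ _ h => sup_le_sup_right (Submodule.map_mono (degreeLE_mono h)) _
  have heM : ∀ b, e b ∈ M b.1 := fun b => Submodule.mem_sup_left
    ⟨Finsupp.single b 1, single_mem_degreeLE (by rw [totalDegree_one, add_zero]),
      by rw [presentation_single, map_one, one_mul]⟩
  have hhom : ∀ m f, f.IsHomogeneous m → f ∈ M m := by
    refine graded_nakayama hP hl M (fun m f hf _ => Submodule.mem_sup_right hf)
      (fun m j f hf => ?_) fun m f hf => ?_
    · obtain ⟨_, ⟨v, hv, rfl⟩, g, hg, rfl⟩ := Submodule.mem_sup.1 hf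
      rw [add_mul]
      refine add_mem (Submodule.mem_sup_left ⟨(X j : MvPolynomial (Fin s) k) • v,
        smul_mem_degreeLE (totalDegree_X j).le hv, ?_⟩)
        (Submodule.mem_sup_right (P.mul_mem_right _ hg))
      rw [presentation_smul, aeval_X, mul_comm]
    · obtain ⟨c, hc⟩ := he.exists_sub_sum_mem m f hf
      exact ⟨_, sum_mem fun i _ => Submodule.smul_mem _ _ (heM ⟨m, i⟩),
        (homogeneousSubmodule (Fin n) k m).sum_mem fun i _ =>
          Submodule.smul_mem _ _ (he.isHomogeneous ⟨m, i⟩), hc⟩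
  rw [← sum_homogeneousComponent f]
  refine sum_mem fun i hi => hM ?_ (hhom i _ (homogeneousComponent_isHomogeneous i f))
  exact (Nat.le_of_lt_succ (Finset.mem_range.1 hi)).trans hf

lemma IsGradedSpanning.sum_hilbertFunction_add_finrank_relations_le
    (he : IsGradedSpanning (P ⊔ Ideal.span (Set.range l)) e) (hP : IsHomogeneousIdeal P)
    (hl : ∀ i, (l i).IsHomogeneous 1) (m : ℕ) :
    (∑ j ∈ Finset.range (m + 1), hilbertFunction P j) +
      Module.finrank k (degreeLE k s Sigma.fst m ⊓ (relations l e P).restrictScalars k :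
        Submodule k _) ≤ ∑ j ∈ Finset.range (m + 1), a j * Nat.multichoose (s + 1) (m - j) := by
  set φ := (Ideal.Quotient.mkₐ k P).toLinearMap ∘ₗ presentation l e
  have hker : LinearMap.ker φ = (relations l e P).restrictScalars k := by
    ext v
    exact Ideal.Quotient.eq_zero_iff_mem
  have hmap : (restrictTotalDegree (Fin n) k m).map (Ideal.Quotient.mkₐ k P).toLinearMap ≤
      (degreeLE k s Sigma.fst m).map φ := by
    rintro _ ⟨f, hf, rfl⟩
    obtain ⟨_, ⟨v, hv, rfl⟩, g, hg, rfl⟩ := Submodule.mem_sup.1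
      (he.mem_map_degreeLE hP hl ((mem_restrictTotalDegree _ _ _).1 hf))
    refine ⟨v, hv, (Ideal.Quotient.eq.2 ?_).symm⟩
    rwa [add_sub_cancel_left]
  rw [← hker]
  calc _ ≤ Module.finrank k ((degreeLE k s Sigma.fst m).map φ) + _ :=
        Nat.add_le_add_right ((sum_hilbertFunction_le hP m).trans (Submodule.finrank_mono hmap)) _
    _ = Module.finrank k (degreeLE k s Sigma.fst m) := finrank_map_add_finrank_inf_ker _ _
    _ ≤ _ := finrank_degreeLE_le m

lemma IsGradedSpanning.rank_relations_le
    {e : (Σ m, Fin (hilbertFunction (P ⊔ Ideal.span (Set.range l)) m)) → MvPolynomial (Fin n) k}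
    (he : IsGradedSpanning (P ⊔ Ideal.span (Set.range l)) e) (hP : IsHomogeneousIdeal P)
    (hl : ∀ i, (l i).IsHomogeneous 1) {G : Polynomial ℤ}
    (hG : hilbertSeries (P ⊔ Ideal.span (Set.range l)) =
      hilbertSeries P * (1 - PowerSeries.X) ^ s + (G : PowerSeries ℤ))
    {q : ℕ} (hGq : G.eval 1 ≤ q) :
    Module.rank (MvPolynomial (Fin s) k) (relations l e P) ≤ q := by
  refine rank_submodule_le fun T hT => ?_
  obtain ⟨c, hc⟩ := exists_card_mul_multichoose_le_finrank_degreeLE_inf hT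
  rw [← Nat.cast_le (α := ℤ)]
  refine (le_eval_one_of_sum_le hG (c := c) fun m => ?_).trans hGq
  refine le_trans (Nat.add_le_add_left ?_ _)
    (he.sum_hilbertFunction_add_finrank_relations_le hP hl m)
  split_ifs with hm
  · exact hc m hm
  · exact Nat.zero_le _

theorem colon_le_partialIdeal_of_eval_one_le_one (hprime : P.IsPrime) (hP : IsHomogeneousIdeal P)
    (hl : ∀ i, (l i).IsHomogeneous 1)
    (hinj : ∀ f : MvPolynomial (Fin s) k, aeval l f ∈ P → f = 0)
    {G : Polynomial ℤ} (hG : hilbertSeries (partialIdeal P l s) =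
      hilbertSeries P * (1 - PowerSeries.X) ^ s + (G : PowerSeries ℤ)) (hG1 : G.eval 1 ≤ 1)
    {t : Fin s} (ht : ¬ (partialIdeal P l t.val).colon {l t} ≤ partialIdeal P l t.val)
    {i : Fin s} (hi : i < t) : (partialIdeal P l i.val).colon {l i} ≤ partialIdeal P l i.val := by
  rw [partialIdeal_eq_sup_span_range] at hG
  obtain ⟨e, he⟩ := exists_isGradedSpanning (P ⊔ Ideal.span (Set.range l))
  have hsat : ∀ ρ : MvPolynomial (Fin s) k, ρ ≠ 0 →
      ∀ v, ρ • v ∈ relations l e P → v ∈ relations l e P := fun ρ hρ v hv => by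
    rw [mem_relations, presentation_smul] at hv
    exact (hprime.mem_or_mem hv).resolve_left fun h => hρ (hinj ρ h)
  obtain ⟨w, hw⟩ := isPrincipal_of_saturated_of_rank_le_one hsat
    (by exact_mod_cast he.rank_relations_le hP hl hG (q := 1) hG1)
  have hsurj : ∀ f, ∃ v, f - presentation l e v ∈ P := fun f => by
    obtain ⟨_, ⟨v, -, rfl⟩, g, hg, rfl⟩ := Submodule.mem_sup.1
      (he.mem_map_degreeLE hP hl (f := f) le_rfl)
    exact ⟨v, by rwa [add_sub_cancel_left]⟩
  exact colon_le_partialIdeal_of_relations_eq_span hsurj hw ht hi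

end GradedSpanning

section Depth

open RingTheory.Sequence CategoryTheory Abelian

lemma subsingleton_linearMap_quotient_of_subsingleton_ext {R : Type*} [CommRing R]
    (N : ModuleCat R) {rs : List R} (M : ModuleCat R) (hreg : IsWeaklyRegular M rs)
    (hext : ∀ j ≤ rs.length, Subsingleton (Ext N M j)) :
    Subsingleton (N →ₗ[R] M ⧸ (Ideal.ofList rs • ⊤ : Submodule R M)) := by
  induction rs generalizing M with
  | nil =>
    have hHom : Subsingleton (N →ₗ[R] M) :=
      have := hext 0 le_rfl
      (Ext.addEquiv₀.trans ModuleCat.homAddEquiv).symm.subsingleton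
    have hbot : (Ideal.ofList ([] : List R) • ⊤ : Submodule R M) = ⊥ := by
      rw [Ideal.ofList_nil, Submodule.bot_smul]
    exact (LinearEquiv.congrRight (Submodule.quotEquivOfEqBot _ hbot)).subsingleton
  | cons x rs ih =>
    rw [isWeaklyRegular_cons_iff] at hreg
    have hquot := ih (ModuleCat.of R (QuotSMulTop x M)) hreg.2 fun j hj => by
      have zero₁ := AddCommGrpCat.isZero_of_iff_subsingleton.mpr (hext j (hj.trans (by simp)))
      have zero₂ := AddCommGrpCat.isZero_of_iff_subsingleton.mpr (hext (j + 1) (by simpa))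
      exact AddCommGrpCat.subsingleton_of_isZero <| ShortComplex.Exact.isZero_of_both_zeros
        ((Ext.covariant_sequence_exact₃' N hreg.1.smulShortComplex_shortExact) j (j + 1) rfl)
        (zero₁.eq_zero_of_src _) (zero₂.eq_zero_of_tgt _)
    exact (LinearEquiv.congrRight
      (Submodule.quotOfListConsSMulTopEquivQuotSMulTopInner M x rs)).subsingleton

theorem length_le_of_le_radical_annihilator.{u} {R M : Type u} [CommRing R] [IsNoetherianRing R]
    [AddCommGroup M] [Module R M] [Module.Finite R M] {I : Ideal R}
    (hI : (I • ⊤ : Submodule R M) ≠ ⊤) {rs : List R} (hrs : IsWeaklyRegular M rs)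
    {y : M ⧸ (Ideal.ofList rs • ⊤ : Submodule R M)} (hy : y ≠ 0)
    (hIy : I ≤ (Submodule.span R {y}).annihilator.radical) {rs' : List R}
    (hrs' : IsRegular M rs') (hmem : ∀ f ∈ rs', f ∈ I) : rs'.length ≤ rs.length := by
  by_contra! hlt
  set U := Submodule.span R {y}
  have hU : Module.support R U ⊆ PrimeSpectrum.zeroLocus I := by
    rwa [Module.support_eq_zeroLocus, PrimeSpectrum.zeroLocus_subset_zeroLocus_iff]
  have hext := ModuleCat.subsingleton_ext_of_exists_isRegular I (ModuleCat.of R U) hU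
    (ModuleCat.of R M) hI.lt_top rs' hmem hrs'
  have hHom := subsingleton_linearMap_quotient_of_subsingleton_ext (ModuleCat.of R U)
    (ModuleCat.of R M) hrs fun j hj => hext j (hj.trans_lt hlt)
  exact hy (LinearMap.congr_fun (hHom.elim U.subtype 0)
    ⟨y, Submodule.mem_span_singleton_self y⟩)

section Quotient

variable {R : Type*} [CommRing R] (P : Ideal R)

lemma smul_top_quotient_eq_map_mkQ (I : Ideal R) :
    (I • ⊤ : Submodule R (R ⧸ P)) = Submodule.map P.mkQ I := by
  rw [← Submodule.range_mkQ P, ← Submodule.map_top, ← Submodule.map_smul'', smul_eq_mul,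
    Ideal.mul_top]

lemma mk_mem_smul_top_iff (I : Ideal R) (f : R) :
    (Submodule.Quotient.mk f : R ⧸ P) ∈ (I • ⊤ : Submodule R (R ⧸ P)) ↔ f ∈ P ⊔ I := by
  rw [smul_top_quotient_eq_map_mkQ, ← Submodule.comap_map_mkQ P I]
  rfl

variable {s : ℕ} (l : Fin s → R)

lemma sup_ofList_take_ofFn (i : ℕ) :
    P ⊔ Ideal.ofList ((List.ofFn l).take i) = partialIdeal P l i := by
  rw [partialIdeal, Ideal.ofList]
  congr 2
  ext f
  simp only [Set.mem_ofPred_eq, List.mem_take_iff_getElem, List.length_ofFn, lt_min_iff,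
    List.getElem_ofFn, Set.mem_image]
  exact ⟨fun ⟨j, hj, hf⟩ => ⟨⟨j, hj.2⟩, hj.1, hf⟩, fun ⟨p, hp, hf⟩ => ⟨p, ⟨hp, p.2⟩, hf⟩⟩

variable {P l}

lemma isWeaklyRegular_take_ofFn {t : ℕ}
    (hreg : ∀ i : Fin s, i.val < t →
      (partialIdeal P l i.val).colon {l i} ≤ partialIdeal P l i.val) :
    IsWeaklyRegular (R ⧸ P) ((List.ofFn l).take t) := by
  refine (isWeaklyRegular_iff _ _).2 fun i hi => ?_
  rw [List.length_take, List.length_ofFn, lt_min_iff] at hi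
  rw [isSMulRegular_quotient_iff_mem_of_smul_mem, (Submodule.Quotient.mk_surjective P).forall]
  intro f hf
  rw [← Submodule.Quotient.mk_smul, mk_mem_smul_top_iff, List.take_take, min_eq_left hi.1.le,
    sup_ofList_take_ofFn, List.getElem_take, List.getElem_ofFn, smul_eq_mul, mul_comm] at hf
  rw [mk_mem_smul_top_iff, List.take_take, min_eq_left hi.1.le, sup_ofList_take_ofFn]
  exact hreg ⟨i, hi.2⟩ hi.1 (Submodule.mem_colon_singleton.2 hf)

end Quotient

variable {k : Type*} [Field k] {n s : ℕ} {P : Ideal (MvPolynomial (Fin n) k)}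
  {l : Fin s → MvPolynomial (Fin n) k} {t : ℕ}

lemma coe_le_depthQuotient (hP : IsHomogeneousIdeal P) (hne : P ≠ ⊤)
    (hl : ∀ i, (l i).IsHomogeneous 1) (ht : t ≤ s)
    (hreg : ∀ i : Fin s, i.val < t →
      (partialIdeal P l i.val).colon {l i} ≤ partialIdeal P l i.val) : t ≤ depthQuotient P := by
  have htop : (⊤ : Submodule (MvPolynomial (Fin n) k) (MvPolynomial (Fin n) k ⧸ P)) ≠
      Ideal.ofList ((List.ofFn l).take t) • ⊤ := by
    rw [ne_comm, smul_top_quotient_eq_map_mkQ, Ne, Submodule.map_mkQ_eq_top,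
      sup_ofList_take_ofFn]
    exact partialIdeal_ne_top hP hne hl t
  refine le_iSup_of_le ⟨(List.ofFn l).take t,
    ⟨isWeaklyRegular_take_ofFn hreg, htop⟩, fun f hf => ?_⟩ (by simp [ht])
  obtain ⟨i, rfl⟩ := (List.mem_ofFn' _ _).1 (List.mem_of_mem_take hf)
  rw [← pow_one (idealOfVars (Fin n) k)]
  exact mem_pow_idealOfVars_of_isHomogeneous (hl i) le_rfl

lemma depthQuotient_le (hP : IsHomogeneousIdeal P) (hne : P ≠ ⊤)
    (hreg : ∀ i : Fin s, i.val < t →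
      (partialIdeal P l i.val).colon {l i} ≤ partialIdeal P l i.val)
    {h : MvPolynomial (Fin n) k} (hh : h ∉ partialIdeal P l t)
    (htor : IsIrrelevant ((partialIdeal P l t).colon {h})) : depthQuotient P ≤ t := by
  have hI : (idealOfVars (Fin n) k • ⊤ :
      Submodule (MvPolynomial (Fin n) k) (MvPolynomial (Fin n) k ⧸ P)) ≠ ⊤ := by
    rw [smul_top_quotient_eq_map_mkQ, Ne, Submodule.map_mkQ_eq_top, idealOfVars,
      ← partialIdeal_eq_sup_span_range]
    exact partialIdeal_ne_top hP hne (isHomogeneous_X k) n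
  refine iSup_le fun ⟨rs', hrs', hmem⟩ => Nat.cast_le.2 ?_
  refine (length_le_of_le_radical_annihilator hI (isWeaklyRegular_take_ofFn hreg)
    (y := Submodule.Quotient.mk (Submodule.Quotient.mk h)) ?_ (fun x hx => ?_) hrs' hmem).trans
    (List.length_take_le t _)
  · rwa [Ne, Submodule.Quotient.mk_eq_zero, mk_mem_smul_top_iff, sup_ofList_take_ofFn]
  · obtain ⟨N, hN⟩ := htor.exists_pow_idealOfVars_le
    refine ⟨N, (Submodule.mem_annihilator_span_singleton _ _).2 ?_⟩
    rw [← Submodule.Quotient.mk_smul, ← Submodule.Quotient.mk_smul, Submodule.Quotient.mk_eq_zero,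
      mk_mem_smul_top_iff, sup_ofList_take_ofFn]
    exact Submodule.mem_colon_singleton.1 (hN (Ideal.pow_mem_pow hx N))

end Depth

section General

variable {k : Type*} [Field k] [Infinite k] {n : ℕ}

lemma forGeneralLinearForms_of_eval_ne_zero {s : ℕ}
    {Q : (Fin s → MvPolynomial (Fin n) k) → Prop} {F : MvPolynomial (Fin s × Fin n) k}
    (hF : F ≠ 0) (hQ : ∀ a : Fin s → Fin n → k, eval (fun p => a p.1 p.2) F ≠ 0 →
      Q (fun j => linearForm (a j))) : ForGeneralLinearForms s n Q := by
  obtain ⟨x, hx⟩ : ∃ x, eval x F ≠ 0 := by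
    by_contra! h
    exact hF (MvPolynomial.funext fun x => by rw [h, map_zero])
  exact ⟨{a | eval (fun p => a p.1 p.2) F ≠ 0}, ⟨{F}, by simp⟩, ⟨fun i j => x (i, j), hx⟩, hQ⟩

variable {P : Ideal (MvPolynomial (Fin n) k)}

theorem hilbertCoeff_partialIdeal_of_lt {s d : ℕ} (hP : IsHomogeneousIdeal P) (hne : P ≠ ⊤)
    (hd : ringKrullDim (MvPolynomial (Fin n) k ⧸ P) = d) (hsd : s ≤ d)
    {l : Fin s → MvPolynomial (Fin n) k} (hl : ∀ i, (l i).IsHomogeneous 1)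
    (hreg : IsFilterRegular P l) {i : ℕ} (hi : i < d - s) :
    hilbertCoeff (partialIdeal P l s) i = hilbertCoeff P i := by
  obtain ⟨G, hG⟩ := exists_hilbertSeries_partialIdeal hP hl hreg le_rfl
  rw [hilbertCoeff_partialIdeal hP hne hd hsd hl hG hi.le, if_neg hi.ne, add_zero]

theorem depthQuotient_eq_of_hilbertCoeff_eq_sub {t d : ℕ} (hprime : P.IsPrime)
    (hP : IsHomogeneousIdeal P) (hd : ringKrullDim (MvPolynomial (Fin n) k ⧸ P) = d)
    (htd : t + 1 ≤ d) {l : Fin (t + 1) → MvPolynomial (Fin n) k}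
    (hl : ∀ i, (l i).IsHomogeneous 1) (hreg : IsFilterRegular P l)
    (h : hilbertCoeff P (d - (t + 1)) = hilbertCoeff (partialIdeal P l (t + 1)) (d - (t + 1)) -
      (-1) ^ (d - (t + 1))) : depthQuotient P = t := by
  have hne := hprime.ne_top
  obtain ⟨_, hGt⟩ := exists_hilbertSeries_partialIdeal hP hl hreg t.le_succ
  obtain ⟨G, hG, htor⟩ := exists_hilbertSeries_partialIdeal_succ hP hl hreg (Fin.last t) hGt
  rw [Fin.val_last] at hG htor
  have hG1 : G.eval 1 = 1 := by
    rw [hilbertCoeff_partialIdeal hP hne hd htd hl hG le_rfl, if_pos rfl, add_sub_assoc,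
      left_eq_add, sub_eq_zero, mul_eq_left₀ (pow_ne_zero _ (by norm_num))] at h
    exact h
  obtain ⟨f, hf, hfJ⟩ := htor (hG1.trans_ne one_ne_zero)
  have hinj := (ringKrullDim_partialIdeal hP hne hl hd htd hG).2
  have hcolon : ∀ i : Fin (t + 1), i.val < t →
      (partialIdeal P l i.val).colon {l i} ≤ partialIdeal P l i.val := fun i hi =>
    colon_le_partialIdeal_of_eval_one_le_one hprime hP hl hinj hG hG1.le
      (t := Fin.last t) (fun hle => hfJ (hle hf)) hi
  exact le_antisymm (depthQuotient_le hP hne hcolon hfJ (hreg (Fin.last t) f hf))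
    (coe_le_depthQuotient hP hne hl t.le_succ hcolon)

end General

lemma hilbertCoeff_map_iterProj {k : Type*} [Field k] {s r : ℕ}
    {l : Fin s → MvPolynomial (Fin (r + s)) k} (hl : ∀ i, (l i).IsHomogeneous 1)
    (hdef : IterProjDefined s r l) (P : Ideal (MvPolynomial (Fin (r + s)) k)) :
    hilbertCoeff (P.map (iterProj s r l)) = hilbertCoeff (partialIdeal P l s) := by
  rw [hilbertCoeff_map (isHomogeneous_iterProj_X s r l) (iterProj_surjective s r l),
    ker_iterProj s r l hl hdef, partialIdeal_eq_sup_span_range]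

end HilbertDepth

end

theorem theorem5p4 {k : Type*} [Field k] [Infinite k] (r s d : ℕ)
    (P : Ideal (MvPolynomial (Fin (r + s)) k)) (hP : P.IsPrime)
    (hhom : HilbertDepth.IsHomogeneousIdeal P)
    (hd : ringKrullDim (MvPolynomial (Fin (r + s)) k ⧸ P) = d)
    (hs : 1 ≤ s) (hsd : s ≤ d) :
    HilbertDepth.ForGeneralLinearForms s (r + s)
      (fun l : Fin s → MvPolynomial (Fin (r + s)) k =>
        HilbertDepth.IterProjDefined s r l ∧
        (∀ i : ℕ, i < d - s →
          HilbertDepth.hilbertCoeff P i =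
            HilbertDepth.hilbertCoeff (P.map (HilbertDepth.iterProj s r l)) i) ∧
        (HilbertDepth.hilbertCoeff P (d - s) =
            HilbertDepth.hilbertCoeff (P.map (HilbertDepth.iterProj s r l)) (d - s)
              - (-1) ^ (d - s) →
          HilbertDepth.depthQuotient P = ((s - 1 : ℕ) : ℕ∞))) := by
  obtain ⟨t, rfl⟩ := Nat.exists_eq_add_of_le' hs
  obtain ⟨F₁, hF₁, hreg⟩ := HilbertDepth.exists_forall_isFilterRegular hP (t + 1)
  obtain ⟨F₂, ⟨b, hb⟩, hdef⟩ := HilbertDepth.exists_forall_iterProjDefined k (t + 1) r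
  have hF₂ : F₂ ≠ 0 := fun h => hb (by rw [h, map_zero])
  refine HilbertDepth.forGeneralLinearForms_of_eval_ne_zero (mul_ne_zero hF₁ hF₂) fun a ha => ?_
  rw [map_mul] at ha
  have hreg := hreg a (left_ne_zero_of_mul ha)
  have hdef := hdef a (right_ne_zero_of_mul ha)
  have hl := fun i => HilbertDepth.isHomogeneous_linearForm (a i)
  rw [HilbertDepth.hilbertCoeff_map_iterProj hl hdef]
  exact ⟨hdef, fun i hi =>
      (HilbertDepth.hilbertCoeff_partialIdeal_of_lt hhom hP.ne_top hd hsd hl hreg hi).symm,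
    HilbertDepth.depthQuotient_eq_of_hilbertCoeff_eq_sub hP hhom hd hsd hl hreg⟩
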